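/- Let $\mathbb K$ be a field of characteristic zero. For $n\ge 1$, a noncrossing partition of $[n]=\{1,\dots,n\}$ is a partition $\pi$ of $[n]$ such that for no two blocks $b\ne b'$ are there $x,z\in b$, $y,t\in b'$ with $x<y<z<t$. Its blocks are partially ordered by nesting: $b\le_\pi b'$ if and only if $b'\subseteq[\min b,\max b]$; $\mathrm{Base}(\pi)$ is the set of minimal blocks, and an ideal of $\pi$ is a set $J$ of blocks such that $b\in J$ and $b\le_\pi b'$ imply $b'\in J$. For a set $B$ of blocks of $\pi$, $\pi_{|B}$ is the noncrossing partition obtained by relabelling the family $B$ along the increasing bijection from $\bigcup B$ onto $[|\bigcup B|]$, with $\pi_{|\emptyset}=1$. Let $\mathbb K[\mathcal{NCP}]$ be the polynomial algebra whose variables are the noncrossing partitions (of $[n]$, for all $n\ge1$), with two algebra morphisms $\Delta,\delta:\mathbb K[\mathcal{NCP}]\to\mathbb K[\mathcal{NCP}]\otimes\mathbb K[\mathcal{NCP}]$ given on noncrossing partitions by $$\Delta(\pi)=\sum_{J\text{ ideal of }\pi}\pi_{|\pi\setminus J}\otimes\prod_{C}\pi_{|\{b\in J\,:\,b\subseteq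 C\}},\qquad \delta(\pi)=\sum_{\sim}\ \pi/{\sim}\ \otimes\prod_{c}\pi_{|c}.$$ Here $C$ runs over the maximal intervals of integers contained in $\bigcup_{b\in J}b$; $\sim$ runs over the equivalence relations on the set of blocks of $\pi$ for which the partition $\pi/{\sim}$, obtained by merging the blocks of each class of $\sim$, is noncrossing; and the last product is over the classes $c$ of $\sim$. The counits are the algebra morphisms to $\mathbb K$ with $\varepsilon_\Delta(\pi)=0$, and $\epsilon_\delta(\pi)=1$ if $\pi$ has exactly one block, $\epsilon_\delta(\pi)=0$ otherwise. The algebra $\mathbb K[X]$ has the coproducts given by the algebra morphisms with $\Delta(X)=X\otimes1+1\otimes X$ and $\delta(X)=X\otimes X$, with counits $P\mapsto P(0)$ and $P\mapsto P(1)$ respectively. There is a unique algebra morphism $\phi_{\mathcal{NCP}}:\mathbb K[\mathcal{NCP}]\to\mathbb K[X]$ compatible with both coproducts and both counits. For a monomial $P=\pi_1\cdots\pi_k$ in noncrossing partitions, let $\mathrm{Bl}(P)=\pi_1\sqcup\dots\sqcup\pi_k$ with the order $\le_P=\le_{\pi_1}\sqcup\dots\sqcup\le_{\pi_k}$. There are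 unique linear maps $\Lambda,\Lambda^s:\mathbb K[\mathcal{NCP}]\to\mathbb K[X]$ such that, for every monomial $P$ and every $n\ge1$, $\Lambda(P)(n)$ is the number of maps $f:\mathrm{Bl}(P)\to[n]$ with $b\le_P b'\Rightarrow f(b)\le f(b')$, and $\Lambda^s(P)(n)$ is the number of those maps $f$ with $b\le_P b',\ b\ne b'\Rightarrow f(b)<f(b')$. Let $\lambda,\lambda^s:\mathbb K[\mathcal{NCP}]\to\mathbb K$ be the characters (algebra morphisms) given on noncrossing partitions by $\lambda(\pi)=1$, and $\lambda^s(\pi)=1$ if $\pi=\mathrm{Base}(\pi)$, $\lambda^s(\pi)=0$ otherwise. Then $$\Lambda=(\phi_{\mathcal{NCP}}\otimes\lambda)\circ\delta,\qquad \Lambda^s=(\phi_{\mathcal{NCP}}\otimes\lambda^s)\circ\delta .$$ -/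

import Mathlib

open scoped TensorProduct Polynomial

namespace NCP

/-! ### Noncrossing families of blocks and noncrossing partitions -/

/-- A finite family of nonempty, pairwise disjoint blocks of natural numbers
is noncrossing if no two different blocks `b`, `b'` contain `x, z ∈ b` and `y, t ∈ b'`
with `x < y < z < t`. -/
structure IsNoncrossing (B : Finset (Finset ℕ)) : Prop where
  nonempty_block : ∀ b ∈ B, b.Nonempty
  disjoint : ∀ b ∈ B, ∀ b' ∈ B, b ≠ b' → Disjoint b b'
  not_crossing : ∀ b ∈ B, ∀ b' ∈ B, b ≠ b' →
    ∀ x ∈ b, ∀ z ∈ b, ∀ y ∈ b', ∀ t ∈ b', ¬ (x < y ∧ y < z ∧ z < t)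

/-- A noncrossing partition of `[n] = {1, …, n}` for some `n ≥ 1`, as its set of blocks
(`n` is determined by the blocks, and `n ≥ 1` because there is at least one block). -/
@[ext]
structure Partition where
  blocks : Finset (Finset ℕ)
  nonempty : blocks.Nonempty
  noncrossing : IsNoncrossing blocks
  ground : ∃ n : ℕ, blocks.sup id = Finset.Icc 1 n

/-- The nesting order: `b ≤ b'` if and only if `b' ⊆ [min b, max b]`. -/
def Nested (b b' : Finset ℕ) : Prop :=
  ∀ y ∈ b', (∃ x ∈ b, x ≤ y) ∧ (∃ z ∈ b, y ≤ z)

/-- The increasing numbering of a finite set `S`: its restriction to `S` is the increasing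
bijection from `S` to `{1, …, |S|}`. -/
def rank (S : Finset ℕ) (x : ℕ) : ℕ := (S.filter (· ≤ x)).card

/-- Standardization of a family of blocks: the underlying set of the family is relabelled by the
increasing bijection onto `{1, …, m}`. A family that is already a partition of `{1, …, m}` is
left unchanged. -/
def std (B : Finset (Finset ℕ)) : Finset (Finset ℕ) :=
  B.image fun b => b.image (rank (B.sup id))

theorem rank_lt_rank {S : Finset ℕ} {x y : ℕ} (hy : y ∈ S) (h : x < y) :
    rank S x < rank S y := by
  refine Finset.card_lt_card (Finset.ssubset_iff_of_subset ?_ |>.2 ⟨y, ?_, ?_⟩)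
  · intro z hz
    simp only [Finset.mem_filter] at hz ⊢
    exact ⟨hz.1, hz.2.trans h.le⟩
  · simp [hy]
  · simp [h]

theorem rank_lt_rank_iff {S : Finset ℕ} {x y : ℕ} (hx : x ∈ S) (hy : y ∈ S) :
    rank S x < rank S y ↔ x < y := by
  refine ⟨fun h => ?_, rank_lt_rank hy⟩
  rcases lt_trichotomy x y with h' | h' | h'
  · exact h'
  · subst h'; exact absurd h (lt_irrefl _)
  · exact absurd h (rank_lt_rank hx h').asymm

theorem rank_inj {S : Finset ℕ} {x y : ℕ} (hx : x ∈ S) (hy : y ∈ S)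
    (h : rank S x = rank S y) : x = y := by
  rcases lt_trichotomy x y with h' | h' | h'
  · exact absurd h (rank_lt_rank hy h').ne
  · exact h'
  · exact absurd h (rank_lt_rank hx h').ne'

theorem mem_sup_of_mem {B : Finset (Finset ℕ)} {b : Finset ℕ} {x : ℕ} (hb : b ∈ B)
    (hx : x ∈ b) : x ∈ B.sup id :=
  Finset.mem_sup.2 ⟨b, hb, hx⟩

theorem std_nonempty {B : Finset (Finset ℕ)} (h : B.Nonempty) : (std B).Nonempty :=
  h.image _

theorem std_isNoncrossing {B : Finset (Finset ℕ)} (h : IsNoncrossing B) :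
    IsNoncrossing (std B) := by
  refine ⟨?_, ?_, ?_⟩
  · intro c hc
    obtain ⟨b, hb, rfl⟩ := Finset.mem_image.1 hc
    exact (h.nonempty_block b hb).image _
  · intro c hc c' hc' hne
    obtain ⟨b, hb, rfl⟩ := Finset.mem_image.1 hc
    obtain ⟨b', hb', rfl⟩ := Finset.mem_image.1 hc'
    have hbb : b ≠ b' := by rintro rfl; exact hne rfl
    rw [Finset.disjoint_left]
    intro u hu hu'
    obtain ⟨x, hx, rfl⟩ := Finset.mem_image.1 hu
    obtain ⟨y, hy, hxy⟩ := Finset.mem_image.1 hu'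
    have hyx := rank_inj (mem_sup_of_mem hb' hy) (mem_sup_of_mem hb hx) hxy
    subst hyx
    exact Finset.disjoint_left.1 (h.disjoint b hb b' hb' hbb) hx hy
  · intro c hc c' hc' hne x' hx' z' hz' y' hy' t' ht'
    obtain ⟨b, hb, rfl⟩ := Finset.mem_image.1 hc
    obtain ⟨b', hb', rfl⟩ := Finset.mem_image.1 hc'
    have hbb : b ≠ b' := by rintro rfl; exact hne rfl
    obtain ⟨x, hx, rfl⟩ := Finset.mem_image.1 hx'
    obtain ⟨z, hz, rfl⟩ := Finset.mem_image.1 hz'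
    obtain ⟨y, hy, rfl⟩ := Finset.mem_image.1 hy'
    obtain ⟨t, ht, rfl⟩ := Finset.mem_image.1 ht'
    rw [rank_lt_rank_iff (mem_sup_of_mem hb hx) (mem_sup_of_mem hb' hy),
      rank_lt_rank_iff (mem_sup_of_mem hb' hy) (mem_sup_of_mem hb hz),
      rank_lt_rank_iff (mem_sup_of_mem hb hz) (mem_sup_of_mem hb' ht)]
    exact h.not_crossing b hb b' hb' hbb x hx z hz y hy t ht

theorem image_rank (S : Finset ℕ) : S.image (rank S) = Finset.Icc 1 S.card := by
  refine Finset.eq_of_subset_of_card_le ?_ ?_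
  · intro u hu
    obtain ⟨x, hx, rfl⟩ := Finset.mem_image.1 hu
    refine Finset.mem_Icc.2 ⟨Finset.card_pos.2 ⟨x, by simp [hx]⟩, ?_⟩
    exact Finset.card_le_card (Finset.filter_subset _ _)
  · rw [Finset.card_image_of_injOn fun x hx y hy => rank_inj hx hy]
    simp

theorem std_ground (B : Finset (Finset ℕ)) :
    (std B).sup id = Finset.Icc 1 (B.sup id).card := by
  rw [← image_rank]
  ext u
  simp only [std, Finset.mem_sup, Finset.mem_image, id]
  constructor
  · rintro ⟨_, ⟨b, hb, rfl⟩, hu⟩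
    obtain ⟨x, hx, rfl⟩ := Finset.mem_image.1 hu
    exact ⟨x, ⟨b, hb, hx⟩, rfl⟩
  · rintro ⟨x, ⟨b, hb, hx⟩, rfl⟩
    exact ⟨_, ⟨b, hb, rfl⟩, Finset.mem_image_of_mem _ hx⟩

/-- The standardization of a nonempty noncrossing family, as a noncrossing partition. -/
def stdPartition (B : Finset (Finset ℕ)) (h : B.Nonempty) (hB : IsNoncrossing B) : Partition where
  blocks := std B
  nonempty := std_nonempty h
  noncrossing := std_isNoncrossing hB
  ground := ⟨_, std_ground B⟩

/-! ### The polynomial algebra generated by noncrossing partitions -/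

/-- The free commutative algebra `K[NCP]` generated by the noncrossing partitions. -/
abbrev Alg (K : Type*) [Field K] := MvPolynomial Partition K

open scoped Classical in
/-- The element of `K[NCP]` given by a noncrossing family of blocks: the generator of its
standardization, or `1` if the family is empty. (It is only applied to noncrossing families.) -/
noncomputable def gen (K : Type*) [Field K] (B : Finset (Finset ℕ)) : Alg K :=
  if h : B.Nonempty ∧ IsNoncrossing B then MvPolynomial.X (stdPartition B h.1 h.2) else 1

/-- A set `J` of blocks of `π` is an ideal if it is upward closed for the nesting order. -/
def IsIdeal (π : Partition) (J : Finset (Finset ℕ)) : Prop :=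
  J ⊆ π.blocks ∧ ∀ b ∈ J, ∀ b' ∈ π.blocks, Nested b b' → b' ∈ J

open scoped Classical in
/-- The connected components of a finite set `S` of natural numbers, that is its maximal
intervals: the component of `x` consists of the `y ∈ S` such that every integer between `x` and
`y` belongs to `S`. -/
noncomputable def components (S : Finset ℕ) : Finset (Finset ℕ) :=
  S.image fun x => S.filter fun y => ∀ z, min x y ≤ z → z ≤ max x y → z ∈ S

/-- For an ideal `J`, the monomial which is the product, over the connected components `C` of the
union of the blocks in `J`, of the standardization of the family of the blocks contained in `C`. -/
noncomputable def cut (K : Type*) [Field K] (J : Finset (Finset ℕ)) : Alg K :=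
  ∏ C ∈ components (J.sup id), gen K (J.filter (· ⊆ C))

open scoped Classical in
/-- The first coproduct: the algebra morphism such that `Δ(π)` is the sum, over the ideals `J` of
`π`, of `π` restricted to the complement of `J`, tensor the monomial associated with `J`. -/
noncomputable def coprod (K : Type*) [Field K] : Alg K →ₐ[K] Alg K ⊗[K] Alg K :=
  MvPolynomial.aeval fun π =>
    ∑ J ∈ π.blocks.powerset.filter (IsIdeal π), gen K (π.blocks \ J) ⊗ₜ[K] cut K J

/-- The counit of the first coproduct, vanishing on every noncrossing partition. -/
noncomputable def counit (K : Type*) [Field K] : Alg K →ₐ[K] K :=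
  MvPolynomial.aeval fun _ => 0

/-- The blocks of `π/∼`: an equivalence `∼` on the blocks of `π` is given by the partition `σ` of
the set of blocks into its classes, and the blocks of each class are merged. -/
def merge {π : Partition} (σ : Finpartition π.blocks) : Finset (Finset ℕ) :=
  σ.parts.image fun C => C.sup id

open scoped Classical in
/-- The extraction-contraction coproduct: the algebra morphism such that `δ(π)` is the sum, over
the equivalences `∼` on the blocks of `π` for which `π/∼` is noncrossing, of `π/∼` tensor the
product of the restrictions of `π` to the classes of `∼`. -/
noncomputable def deltaCoprod (K : Type*) [Field K] : Alg K →ₐ[K] Alg K ⊗[K] Alg K :=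
  MvPolynomial.aeval fun π =>
    ∑ σ ∈ (Finset.univ : Finset (Finpartition π.blocks)).filter fun σ => IsNoncrossing (merge σ),
      gen K (merge σ) ⊗ₜ[K] ∏ C ∈ σ.parts, gen K C

/-- The counit of the extraction-contraction coproduct: `1` on partitions with exactly one block
and `0` on the other ones. -/
noncomputable def deltaCounit (K : Type*) [Field K] : Alg K →ₐ[K] K :=
  MvPolynomial.aeval fun π => if π.blocks.card = 1 then 1 else 0

/-! ### Double bialgebra morphisms to `K[X]` -/

/-- The coproduct of `K[X]` with `Δ(X) = X ⊗ 1 + 1 ⊗ X`; its counit is evaluation at `0`. -/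
noncomputable def polyCoprod (K : Type*) [Field K] : K[X] →ₐ[K] K[X] ⊗[K] K[X] :=
  Polynomial.aeval (Polynomial.X ⊗ₜ[K] 1 + 1 ⊗ₜ[K] Polynomial.X)

/-- The coproduct of `K[X]` with `δ(X) = X ⊗ X`; its counit is evaluation at `1`. -/
noncomputable def polyDelta (K : Type*) [Field K] : K[X] →ₐ[K] K[X] ⊗[K] K[X] :=
  Polynomial.aeval (Polynomial.X ⊗ₜ[K] Polynomial.X)

/-- An algebra morphism `K[NCP] → K[X]` is a double bialgebra morphism if it is compatible with
both coproducts and with both counits. -/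
structure IsDoubleBialgHom {K : Type*} [Field K] (φ : Alg K →ₐ[K] K[X]) : Prop where
  map_coprod : (polyCoprod K).comp φ = (Algebra.TensorProduct.map φ φ).comp (coprod K)
  map_counit : ∀ x, (φ x).eval 0 = counit K x
  map_delta : (polyDelta K).comp φ = (Algebra.TensorProduct.map φ φ).comp (deltaCoprod K)
  map_deltaCounit : ∀ x, (φ x).eval 1 = deltaCounit K x

/-- The right action `φ ↜ χ = (φ ⊗ χ) ∘ δ` of a character `χ` of `K[NCP]`. -/
noncomputable def act {K : Type*} [Field K] (φ : Alg K →ₐ[K] K[X]) (χ : Alg K →ₐ[K] K) :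
    Alg K →ₐ[K] K[X] :=
  ((Algebra.TensorProduct.rid K K K[X]).toAlgHom.comp
    (Algebra.TensorProduct.map φ χ)).comp (deltaCoprod K)

/-! ### The two characters -/

open scoped Classical in
/-- The set of blocks of `π` which are minimal for the nesting order. -/
noncomputable def base (π : Partition) : Finset (Finset ℕ) :=
  π.blocks.filter fun b => ∀ b' ∈ π.blocks, Nested b' b → b' = b

/-- The character equal to `1` on every noncrossing partition. -/
noncomputable def charOne (K : Type*) [Field K] : Alg K →ₐ[K] K :=
  MvPolynomial.aeval fun _ => 1

/-- The character equal to `1` on the noncrossing partitions without nesting, that is `π` equal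
to its base, and to `0` on the other ones. -/
noncomputable def charStrict (K : Type*) [Field K] : Alg K →ₐ[K] K :=
  MvPolynomial.aeval fun π => if π.blocks = base π then 1 else 0

/-! ### Linear extensions of monomials -/

/-- The blocks of a monomial `P`, the disjoint union of the sets of blocks of its factors, counted
with multiplicity. -/
abbrev Bl (P : Partition →₀ ℕ) : Type :=
  Σ c : (Σ π : {π // π ∈ P.support}, Fin (P π)), {b // b ∈ c.1.1.blocks}

/-- The nesting order on the blocks of a monomial: blocks of different factors are not
comparable. -/
def BlLe {P : Partition →₀ ℕ} (b b' : Bl P) : Prop :=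
  b.1 = b'.1 ∧ Nested b.2.1 b'.2.1

/-- The `n`-linear extensions of a monomial. -/
def Lin (P : Partition →₀ ℕ) (n : ℕ) : Set (Bl P → Fin n) :=
  {f | ∀ b b', BlLe b b' → f b ≤ f b'}

/-- The strict `n`-linear extensions of a monomial. -/
def LinStrict (P : Partition →₀ ℕ) (n : ℕ) : Set (Bl P → Fin n) :=
  {f | ∀ b b', BlLe b b' → b ≠ b' → f b < f b'}

/-- The linear map `Λ` is characterized by `Λ(P)(n) = |Lin(P, n)|` for every monomial `P` and
every `n ≥ 1`. -/
def IsLinPoly {K : Type*} [Field K] (L : Alg K →ₗ[K] K[X]) : Prop :=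
  ∀ (P : Partition →₀ ℕ) (n : ℕ), 1 ≤ n →
    (L (MvPolynomial.monomial P 1)).eval (n : K) = ((Lin P n).ncard : K)

/-- The linear map `Λˢ` is characterized by `Λˢ(P)(n) = |Linˢ(P, n)|` for every monomial `P` and
every `n ≥ 1`. -/
def IsStrictLinPoly {K : Type*} [Field K] (L : Alg K →ₗ[K] K[X]) : Prop :=
  ∀ (P : Partition →₀ ℕ) (n : ℕ), 1 ≤ n →
    (L (MvPolynomial.monomial P 1)).eval (n : K) = ((LinStrict P n).ncard : K)

end NCP

namespace NCP

/-! ### Polynomials determined by their values at natural numbers -/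

section Polynomials

variable {K : Type*} [Field K]

/-! The morphism φ counts colourings. Colour the ground set of π by a totally ordered set, and call
two elements connected when they have the same colour and no element between them has a smaller one
(`Conn`). Let N_π(n) be the number of colourings by n colours whose connectedness classes are
exactly the blocks of π. Only the order of the colours matters, so N_π(n) is a polynomial in n
(`numColorings_fin`); it defines `colorHom`.

Both coproducts come from splitting the colours. With the lexicographic sum of m and n colours, the
blocks with upper colours form an ideal J, and the lower elements cut J into its interval
components: this is Δ (`numCol_lex_sum`). With the lexicographic product, the first coordinate
connects at least what the pair connects, so its classes are those of a noncrossing quotient π/∼,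
and the second coordinate colours each class independently: this is δ (`numCol_lex_prod`). The
counits are the values at 0 and 1. Conversely, Δ and the counits determine all values at natural
numbers (`IsDoubleBialgHom.unique`).

An increasing map f on the blocks colours each element by the value of its block. This colouring
connects the elements of each block, so its classes are those of a unique noncrossing π/∼
(`existsUnique_merge`), and every colouring with classes π/∼ arises from one such f
(`card_isLin_merge`). Hence |Lin(π, n)| is the sum of N_{π/∼}(n) over ∼, which is the value at n of
(φ ⊗ λ) ∘ δ. Moreover f is strict exactly when no class of ∼ contains two nested blocks
(`IsLin.isLinStrict_iff`), which is what λˢ detects. Monomials follow by multiplicativity. -/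

theorem poly_eq_of_eval_nat [CharZero K] {p q : K[X]}
    (h : ∀ n : ℕ, 1 ≤ n → p.eval (n : K) = q.eval (n : K)) : p = q := by
  refine Polynomial.eq_of_infinite_eval_eq p q ?_
  refine Set.Infinite.mono ?_
    ((Set.infinite_range_of_injective (f := fun n : ℕ => ((n + 1 : ℕ) : K)) ?_))
  · rintro _ ⟨n, rfl⟩
    exact h (n + 1) (by omega)
  · intro a b hab
    have := Nat.cast_injective (R := K) hab
    omega

/-- Evaluation of both tensor factors. -/
noncomputable def evalTensor (a b : K) : K[X] ⊗[K] K[X] →ₐ[K] K :=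
  (Algebra.TensorProduct.lmul' K).comp
    (Algebra.TensorProduct.map (Polynomial.aeval a) (Polynomial.aeval b))

@[simp] theorem evalTensor_tmul (a b : K) (p q : K[X]) :
    evalTensor a b (p ⊗ₜ q) = p.eval a * q.eval b := by
  simp [evalTensor, Polynomial.aeval_def, Polynomial.eval₂_eq_eval_map]

theorem evalTensor_polyEquivTensor (a b : K) (p : K[X][X]) :
    evalTensor a b (polyEquivTensor K K[X] p) = (p.map (Polynomial.evalRingHom a)).eval b := by
  induction p using Polynomial.induction_on' with
  | add p q hp hq => rw [map_add, map_add, hp, hq, Polynomial.map_add, Polynomial.eval_add]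
  | monomial n r => simp [polyEquivTensor_apply, Polynomial.eval₂_monomial]

/-- A tensor is a polynomial with coefficients in K[X]. For fixed m the values at all n determine
its coefficients evaluated at m; letting m vary determines the coefficients themselves. -/
theorem tensor_ext_of_eval [CharZero K] {s t : K[X] ⊗[K] K[X]}
    (h : ∀ m n : ℕ, evalTensor (m : K) (n : K) s = evalTensor (m : K) (n : K) t) : s = t := by
  obtain ⟨p, rfl⟩ := (polyEquivTensor K K[X]).surjective s
  obtain ⟨q, rfl⟩ := (polyEquivTensor K K[X]).surjective t
  simp only [evalTensor_polyEquivTensor] at h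
  congr 1
  ext1 k
  refine poly_eq_of_eval_nat fun m _ => ?_
  have := poly_eq_of_eval_nat fun n _ => h m n
  simpa using congrArg (fun r => r.coeff k) this

theorem evalTensor_polyCoprod (a b : K) (p : K[X]) :
    evalTensor a b (polyCoprod K p) = p.eval (a + b) := by
  have : (evalTensor a b).comp (polyCoprod K) = Polynomial.aeval (a + b) := by
    ext; simp [polyCoprod]
  simpa [Polynomial.aeval_def, Polynomial.eval₂_eq_eval_map] using DFunLike.congr_fun this p

theorem evalTensor_polyDelta (a b : K) (p : K[X]) :
    evalTensor a b (polyDelta K p) = p.eval (a * b) := by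
  have : (evalTensor a b).comp (polyDelta K) = Polynomial.aeval (a * b) := by
    ext; simp [polyDelta]
  simpa [Polynomial.aeval_def, Polynomial.eval₂_eq_eval_map] using DFunLike.congr_fun this p

/-- The polynomial whose value at `n` is `∑ₖ p k * n.choose k`, for `k ≤ N`. -/
noncomputable def binomialPoly (K : Type*) [Field K] (N : ℕ) (p : ℕ → ℕ) : K[X] :=
  ∑ k ∈ Finset.range (N + 1),
    Polynomial.C ((p k : K) / (k.factorial : K)) * descPochhammer K k

theorem eval_binomialPoly [CharZero K] (N : ℕ) (p : ℕ → ℕ) (n : ℕ) :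
    (binomialPoly K N p).eval (n : K) =
      ((∑ k ∈ Finset.range (N + 1), n.choose k * p k : ℕ) : K) := by
  simp only [binomialPoly, Polynomial.eval_finsetSum, Polynomial.eval_mul, Polynomial.eval_C,
    descPochhammer_eval_eq_descFactorial, Nat.descFactorial_eq_factorial_mul_choose]
  push_cast
  refine Finset.sum_congr rfl fun k _ => ?_
  have : (k.factorial : K) ≠ 0 := Nat.cast_ne_zero.2 k.factorial_ne_zero
  field_simp

end Polynomials

/-! ### Counting by fibres -/

/-- Used to cut a set of colourings according to the unique ideal, equivalence or set of colours
attached to each of them. -/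
theorem card_eq_sum_card {E ι : Type*} [Finite E] (s : Finset ι) (R : E → ι → Prop)
    (h : ∀ e, ∃! i, i ∈ s ∧ R e i) :
    Nat.card E = ∑ i ∈ s, Nat.card {e // R e i} := by
  rw [← Finset.sum_coe_sort, ← Nat.card_sigma]
  refine Nat.card_congr (Equiv.ofBijective (fun e => ⟨⟨(h e).choose, (h e).choose_spec.1.1⟩,
    ⟨e, (h e).choose_spec.1.2⟩⟩) ⟨?_, ?_⟩)
  · intro e e' hee
    have := congrArg (fun z : (Σ i : s, {e // R e i.1}) => z.2.1) hee
    simpa using this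
  · rintro ⟨⟨i, hi⟩, ⟨e, he⟩⟩
    obtain rfl : (h e).choose = i := ((h e).choose_spec.2 i ⟨hi, he⟩).symm
    exact ⟨e, rfl⟩

/-! ### Colourings -/

section Conn

variable {T T' α β : Type*} [LinearOrder T] [LinearOrder T'] [LinearOrder α] [LinearOrder β]

/-- Two elements are connected by the colouring `c` if they have the same colour and no element
between them has a smaller colour. -/
def Conn (c : T → α) (x y : T) : Prop :=
  c x = c y ∧ ∀ z ∈ Set.uIcc x y, c x ≤ c z

theorem Conn.refl (c : T → α) (x : T) : Conn c x x :=
  ⟨rfl, fun z hz => by simp at hz; rw [hz]⟩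

theorem Conn.symm {c : T → α} {x y : T} (h : Conn c x y) : Conn c y x :=
  ⟨h.1.symm, fun z hz => h.1 ▸ h.2 z (Set.uIcc_comm x y ▸ hz)⟩

theorem Conn.trans {c : T → α} {x y z : T} (h : Conn c x y) (h' : Conn c y z) : Conn c x z :=
  ⟨h.1.trans h'.1, fun u hu => by
    rcases Set.uIcc_subset_uIcc_union_uIcc (b := y) hu with hu | hu
    · exact h.2 u hu
    · exact h.1 ▸ h'.2 u hu⟩

theorem conn_comp_strictMono {e : α → β} (he : StrictMono e) (c : T → α) (x y : T) :
    Conn (e ∘ c) x y ↔ Conn c x y := by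
  simp [Conn, he.injective.eq_iff, he.le_iff_le]

theorem conn_comp_orderIso (e : T' ≃o T) (c : T → α) (x y : T') :
    Conn (c ∘ e) x y ↔ Conn c (e x) (e y) := by
  refine and_congr Iff.rfl ⟨fun h z hz => ?_, fun h z hz => ?_⟩
  · have := h (e.symm z) ?_
    · simpa using this
    · rw [Set.mem_uIcc] at hz ⊢
      simpa [e.symm_apply_le, e.le_symm_apply] using hz
  · refine h (e z) ?_
    rw [Set.mem_uIcc] at hz ⊢
    simpa using hz

/-- The number of colourings whose connectedness relation is `r`. -/
noncomputable def numColorings (T : Type*) [LinearOrder T] (r : T → T → Prop)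
    (α : Type*) [LinearOrder α] : ℕ :=
  Nat.card {c : T → α // ∀ x y, Conn c x y ↔ r x y}

theorem numColorings_congr (e : T' ≃o T) (f : α ≃o β) {r : T → T → Prop} {r' : T' → T' → Prop}
    (h : ∀ x y, r' x y ↔ r (e x) (e y)) :
    numColorings T r α = numColorings T' r' β := by
  refine Nat.card_congr ((Equiv.arrowCongr e.symm.toEquiv f.toEquiv).subtypeEquiv fun c => ?_)
  have : (Equiv.arrowCongr e.symm.toEquiv f.toEquiv) c = (f ∘ c) ∘ e := rfl
  rw [this]
  simp only [conn_comp_orderIso, conn_comp_strictMono f.strictMono, h]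
  refine ⟨fun H x y => H _ _, fun H x y => ?_⟩
  simpa using H (e.symm x) (e.symm y)

/-- The number of surjective colourings with `k` colours whose connectedness relation is `r`. -/
noncomputable def numSurjColorings (T : Type*) [LinearOrder T] (r : T → T → Prop) (k : ℕ) : ℕ :=
  Nat.card {c : T → Fin k // Function.Surjective c ∧ ∀ x y, Conn c x y ↔ r x y}

/-- A colouring amounts to the set s of colours used together with a surjective colouring by |s|
colours, because connectedness is unchanged by an increasing relabelling of the colours. The sum
stops at |T|, so it is polynomial in n. -/
theorem numColorings_fin [Fintype T] (r : T → T → Prop) (n : ℕ) :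
    numColorings T r (Fin n) =
      ∑ k ∈ Finset.range (Fintype.card T + 1), n.choose k * numSurjColorings T r k := by
  classical
  have key : numColorings T r (Fin n) =
      ∑ s ∈ (Finset.univ : Finset (Fin n)).powerset, numSurjColorings T r s.card := by
    unfold numColorings
    rw [card_eq_sum_card (Finset.univ : Finset (Fin n)).powerset
      (fun c s => Finset.univ.image c.1 = s) (fun c => ⟨_, ⟨by simp, rfl⟩, fun s hs => hs.2.symm⟩)]
    refine Finset.sum_congr rfl fun s _ => ?_
    symm
    refine Nat.card_congr (Equiv.ofBijective (fun d => ⟨⟨s.orderEmbOfFin rfl ∘ d.1, ?_⟩, ?_⟩)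
      ⟨?_, ?_⟩)
    · simpa only [conn_comp_strictMono (s.orderEmbOfFin rfl).strictMono] using d.2.2
    · rw [← Finset.image_image, Finset.image_univ_of_surjective d.2.1]
      exact Finset.image_orderEmbOfFin_univ s rfl
    · intro d d' h
      have h' := congrArg (fun z => z.1.1) h
      exact Subtype.ext ((s.orderEmbOfFin rfl).injective.comp_left h')
    · rintro ⟨⟨c, hc⟩, hs⟩
      simp only at hs
      have hmem : ∀ x, c x ∈ s := fun x => hs ▸ Finset.mem_image_of_mem _ (Finset.mem_univ x)
      have hd : s.orderEmbOfFin rfl ∘ (fun x => (s.orderIsoOfFin rfl).symm ⟨c x, hmem x⟩) = c := by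
        funext x
        simp [Finset.orderEmbOfFin]
      refine ⟨⟨fun x => (s.orderIsoOfFin rfl).symm ⟨c x, hmem x⟩, ?_, ?_⟩, ?_⟩
      · intro i
        have hi : (s.orderIsoOfFin rfl i).1 ∈ Finset.univ.image c := hs ▸ (s.orderIsoOfFin rfl i).2
        obtain ⟨x, -, hx⟩ := Finset.mem_image.1 hi
        exact ⟨x, by rw [OrderIso.symm_apply_eq]; exact Subtype.ext hx⟩
      · intro x y
        rw [← hc x y, ← conn_comp_strictMono (s.orderEmbOfFin rfl).strictMono, hd]
      · exact Subtype.ext (Subtype.ext hd)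
  rw [key, Finset.sum_powerset_apply_card (fun k => numSurjColorings T r k)]
  simp only [Finset.card_univ, Fintype.card_fin, smul_eq_mul]
  have hzero : ∀ k, Fintype.card T < k → numSurjColorings T r k = 0 := by
    intro k hk
    have : IsEmpty {c : T → Fin k // Function.Surjective c ∧ ∀ x y, Conn c x y ↔ r x y} :=
      ⟨fun c => by simpa using (Fintype.card_le_of_surjective _ c.2.1).trans_lt hk⟩
    exact Nat.card_of_isEmpty
  -- Both sums extend to a common range: the binomials vanish beyond n, the numbers of surjective
  -- colourings beyond |T|.
  have h1 : Finset.range (n + 1) ⊆ Finset.range (n + Fintype.card T + 1) := by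
    intro k; simp only [Finset.mem_range]; omega
  have h2 : Finset.range (Fintype.card T + 1) ⊆ Finset.range (n + Fintype.card T + 1) := by
    intro k; simp only [Finset.mem_range]; omega
  rw [Finset.sum_subset h1, Finset.sum_subset h2]
  · intro k _ hk
    rw [hzero k (by simpa using hk), mul_zero]
  · intro k _ hk
    rw [Nat.choose_eq_zero_of_lt (by simpa using hk), zero_mul]

/-- The polynomial which counts the colourings whose connectedness relation is `r`. -/
noncomputable def coloringPoly (K : Type*) [Field K] (T : Type*) [LinearOrder T] [Fintype T]
    (r : T → T → Prop) : K[X] :=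
  binomialPoly K (Fintype.card T) (numSurjColorings T r)

theorem eval_coloringPoly {K : Type*} [Field K] [CharZero K] [Fintype T] (r : T → T → Prop)
    (n : ℕ) : (coloringPoly K T r).eval (n : K) = (numColorings T r (Fin n) : K) := by
  rw [coloringPoly, eval_binomialPoly, numColorings_fin]

end Conn

/-! ### Colourings of noncrossing families -/

/-- Two elements belong to the same block of the family `B`. -/
def SameBlock (B : Finset (Finset ℕ)) (x y : ℕ) : Prop := ∃ b ∈ B, x ∈ b ∧ y ∈ b

theorem mem_sup_iff {B : Finset (Finset ℕ)} {x : ℕ} : x ∈ B.sup id ↔ ∃ b ∈ B, x ∈ b := by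
  simp [Finset.mem_sup]

/-- The number of colourings of the ground set of `B` whose connectedness classes are the blocks
of `B`. -/
noncomputable def numCol (B : Finset (Finset ℕ)) (α : Type*) [LinearOrder α] : ℕ :=
  numColorings ↥(B.sup id) (fun x y => SameBlock B x y) α

theorem numCol_congr (B : Finset (Finset ℕ)) {α β : Type*} [LinearOrder α] [LinearOrder β]
    (f : α ≃o β) : numCol B α = numCol B β :=
  numColorings_congr (OrderIso.refl _) f fun _ _ => Iff.rfl

theorem numColorings_eq_numCol {S : Finset ℕ} {B : Finset (Finset ℕ)} (h : B.sup id = S)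
    (α : Type*) [LinearOrder α] :
    numColorings ↥S (fun x y => SameBlock B x y) α = numCol B α := by
  subst h; rfl

theorem sameBlock_std {B : Finset (Finset ℕ)} {x y : ℕ} (hx : x ∈ B.sup id) (hy : y ∈ B.sup id) :
    SameBlock (std B) (rank (B.sup id) x) (rank (B.sup id) y) ↔ SameBlock B x y := by
  constructor
  · rintro ⟨_, hb₀, hxb, hyb⟩
    obtain ⟨b, hb, rfl⟩ := Finset.mem_image.1 hb₀
    obtain ⟨x', hx', hxx⟩ := Finset.mem_image.1 hxb
    obtain ⟨y', hy', hyy⟩ := Finset.mem_image.1 hyb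
    rw [rank_inj (mem_sup_of_mem hb hx') hx hxx] at hx'
    rw [rank_inj (mem_sup_of_mem hb hy') hy hyy] at hy'
    exact ⟨b, hb, hx', hy'⟩
  · rintro ⟨b, hb, hxb, hyb⟩
    exact ⟨_, Finset.mem_image_of_mem _ hb, Finset.mem_image_of_mem _ hxb,
      Finset.mem_image_of_mem _ hyb⟩

theorem rank_mem_std {B : Finset (Finset ℕ)} {x : ℕ} (hx : x ∈ B.sup id) :
    rank (B.sup id) x ∈ (std B).sup id := by
  rw [std_ground, ← image_rank]
  exact Finset.mem_image_of_mem _ hx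

/-- The increasing bijection from the ground set of a family to that of its standardization. -/
noncomputable def rankIso (B : Finset (Finset ℕ)) : ↥(B.sup id) ≃o ↥((std B).sup id) :=
  StrictMono.orderIsoOfSurjective (fun x => ⟨rank (B.sup id) x, rank_mem_std x.2⟩)
    (fun _ y h => rank_lt_rank y.2 h) (by
      rintro ⟨y, hy⟩
      rw [std_ground, ← image_rank] at hy
      obtain ⟨x, hx, rfl⟩ := Finset.mem_image.1 hy
      exact ⟨⟨x, hx⟩, rfl⟩)

theorem numCol_std (B : Finset (Finset ℕ)) (α : Type*) [LinearOrder α] :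
    numCol (std B) α = numCol B α :=
  numColorings_congr (rankIso B) (OrderIso.refl _) fun x y => (sameBlock_std x.2 y.2).symm

/-- Matches the convention that `gen` is 1 on the empty family, which occurs in Δ when the ideal
consists of all the blocks. -/
theorem numCol_empty (α : Type*) [LinearOrder α] : numCol ∅ α = 1 := by
  have : IsEmpty ↥((∅ : Finset (Finset ℕ)).sup id) := ⟨fun x => by simpa using x.2⟩
  unfold numCol numColorings
  have : Unique {c : ↥((∅ : Finset (Finset ℕ)).sup id) → α //
      ∀ x y, Conn c x y ↔ SameBlock ∅ x y} :=
    { default := ⟨isEmptyElim, fun x => isEmptyElim x⟩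
      uniq := fun c => Subtype.ext (funext fun x => isEmptyElim x) }
  exact Nat.card_unique

theorem IsNoncrossing.mono {B B' : Finset (Finset ℕ)} (h : IsNoncrossing B) (hB : B' ⊆ B) :
    IsNoncrossing B' :=
  ⟨fun b hb => h.nonempty_block b (hB hb), fun b hb b' hb' => h.disjoint b (hB hb) b' (hB hb'),
    fun b hb b' hb' => h.not_crossing b (hB hb) b' (hB hb')⟩

theorem IsNoncrossing.eq_of_mem {B : Finset (Finset ℕ)} (h : IsNoncrossing B) {b b' : Finset ℕ}
    {x : ℕ} (hb : b ∈ B) (hb' : b' ∈ B) (hx : x ∈ b) (hx' : x ∈ b') : b = b' := by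
  by_contra hne
  exact Finset.disjoint_left.1 (h.disjoint b hb b' hb' hne) hx hx'

/-- A single element of b' between two elements of b is enough: another element of b' outside the
interval they span would give a crossing. -/
theorem IsNoncrossing.nested {B : Finset (Finset ℕ)} (h : IsNoncrossing B) {b b' : Finset ℕ}
    (hb : b ∈ B) (hb' : b' ∈ B) {x y z : ℕ} (hx : x ∈ b) (hy : y ∈ b') (hz : z ∈ b)
    (hxy : x ≤ y) (hyz : y ≤ z) : Nested b b' := by
  by_cases hne : b = b'
  · subst hne
    exact fun y hy => ⟨⟨y, hy, le_rfl⟩, ⟨y, hy, le_rfl⟩⟩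
  have hxy' : x < y := lt_of_le_of_ne hxy fun e => hne (h.eq_of_mem hb hb' hx (e ▸ hy))
  have hyz' : y < z := lt_of_le_of_ne hyz fun e => hne (h.eq_of_mem hb hb' hz (e ▸ hy))
  intro t ht
  refine ⟨⟨x, hx, ?_⟩, ⟨z, hz, ?_⟩⟩
  · by_contra! htx
    exact h.not_crossing b' hb' b hb (Ne.symm hne) t ht y hy x hx z hz ⟨htx, hxy', hyz'⟩
  · by_contra! hzt
    exact h.not_crossing b hb b' hb' hne x hx z hz y hy t ht ⟨hxy', hyz', hzt⟩

theorem IsNoncrossing.sameBlock_iff {B : Finset (Finset ℕ)} (h : IsNoncrossing B)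
    {b b' : Finset ℕ} {x y : ℕ} (hb : b ∈ B) (hb' : b' ∈ B) (hx : x ∈ b) (hy : y ∈ b') :
    SameBlock B x y ↔ b = b' := by
  constructor
  · rintro ⟨d, hd, hxd, hyd⟩
    exact (h.eq_of_mem hb hd hx hxd).trans (h.eq_of_mem hd hb' hyd hy)
  · rintro rfl
    exact ⟨b, hb, hx, hy⟩

/-- Colourings of a disjoint union are families of colourings of the pieces. -/
theorem card_glue {ι α : Type*} [Fintype ι] (S : Finset ℕ) (A : ι → Finset ℕ)
    (hd : ∀ i j x, x ∈ A i → x ∈ A j → i = j) (hS : ∀ x, x ∈ S ↔ ∃ i, x ∈ A i)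
    (Q : ∀ i, (A i → α) → Prop) :
    Nat.card {c : S → α // ∀ i, Q i fun x => c ⟨x, (hS x).2 ⟨i, x.2⟩⟩} =
      ∏ i, Nat.card {d : A i → α // Q i d} := by
  rw [← Nat.card_pi]
  refine Nat.card_congr (Equiv.ofBijective (fun c i => ⟨_, c.2 i⟩) ⟨?_, ?_⟩)
  · intro c c' h
    refine Subtype.ext (funext fun x => ?_)
    obtain ⟨i, hi⟩ := (hS x).1 x.2
    exact congrFun (congrArg Subtype.val (congrFun h i)) ⟨x, hi⟩
  · intro d
    have hch : ∀ x : S, ∃ i, x.1 ∈ A i := fun x => (hS x).1 x.2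
    choose f hf using hch
    have hkey : ∀ i j (x : ℕ) (hi : x ∈ A i) (hj : x ∈ A j),
        (d i).1 ⟨x, hi⟩ = (d j).1 ⟨x, hj⟩ := by
      intro i j x hi hj
      obtain rfl := hd i j x hi hj
      rfl
    have hres : ∀ i, (fun x : A i => (d (f ⟨x, (hS x).2 ⟨i, x.2⟩⟩)).1
        ⟨x, hf ⟨x, (hS x).2 ⟨i, x.2⟩⟩⟩) = (d i).1 := fun i => funext fun x => hkey _ _ _ _ _
    refine ⟨⟨fun x => (d (f x)).1 ⟨x, hf x⟩, fun i => ?_⟩, ?_⟩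
    · rw [hres i]
      exact (d i).2
    · exact funext fun i => Subtype.ext (hres i)

/-! ### Classes of a colouring -/

theorem sameBlock_merge {π : Partition} (σ : Finpartition π.blocks) {b b' : Finset ℕ} {x y : ℕ}
    (hb : b ∈ π.blocks) (hb' : b' ∈ π.blocks) (hx : x ∈ b) (hy : y ∈ b') :
    SameBlock (merge σ) x y ↔ b' ∈ σ.part b := by
  constructor
  · rintro ⟨_, hQ, hxP, hyP⟩
    obtain ⟨P, hP, rfl⟩ := Finset.mem_image.1 hQ
    obtain ⟨d, hd, hxd⟩ := mem_sup_iff.1 hxP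
    obtain ⟨d', hd', hyd⟩ := mem_sup_iff.1 hyP
    obtain rfl := π.noncrossing.eq_of_mem hb (σ.le hP hd) hx hxd
    obtain rfl := π.noncrossing.eq_of_mem hb' (σ.le hP hd') hy hyd
    rwa [σ.part_eq_of_mem hP hd]
  · intro h
    exact ⟨_, Finset.mem_image_of_mem _ (σ.part_mem.2 hb),
      mem_sup_of_mem (σ.mem_part hb) hx, mem_sup_of_mem h hy⟩

theorem sup_merge {π : Partition} (σ : Finpartition π.blocks) :
    (merge σ).sup id = π.blocks.sup id := by
  ext x
  simp only [mem_sup_iff, merge, Finset.mem_image]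
  constructor
  · rintro ⟨_, ⟨P, hP, rfl⟩, hx⟩
    obtain ⟨b, hb, hx⟩ := mem_sup_iff.1 hx
    exact ⟨b, σ.le hP hb, hx⟩
  · rintro ⟨b, hb, hx⟩
    exact ⟨_, ⟨_, σ.part_mem.2 hb, rfl⟩, mem_sup_of_mem (σ.mem_part hb) hx⟩

theorem finpartition_eq_of_part {π : Partition} {σ τ : Finpartition π.blocks}
    (h : ∀ b ∈ π.blocks, ∀ b' ∈ π.blocks, b' ∈ σ.part b ↔ b' ∈ τ.part b) : σ = τ := by
  have hpart : ∀ b ∈ π.blocks, σ.part b = τ.part b := by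
    intro b hb
    ext b'
    refine ⟨fun hb' => (h b hb b' ?_).1 hb', fun hb' => (h b hb b' ?_).2 hb'⟩
    · exact σ.le (σ.part_mem.2 hb) hb'
    · exact τ.le (τ.part_mem.2 hb) hb'
  refine Finpartition.ext (Finset.ext fun P => ⟨fun hP => ?_, fun hP => ?_⟩)
  · obtain ⟨b, hb⟩ := σ.nonempty_of_mem_parts hP
    rw [← σ.part_eq_of_mem hP hb, hpart b (σ.le hP hb)]
    exact τ.part_mem.2 (σ.le hP hb)
  · obtain ⟨b, hb⟩ := τ.nonempty_of_mem_parts hP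
    rw [← τ.part_eq_of_mem hP hb, ← hpart b (τ.le hP hb)]
    exact σ.part_mem.2 (τ.le hP hb)

/-- The classes of a colouring which connects the elements of each block of `π` define a unique
equivalence on the blocks of `π`, and its quotient is noncrossing. -/
theorem existsUnique_merge {π : Partition} {α : Type*} [LinearOrder α]
    (c : ↥(π.blocks.sup id) → α) (hc : ∀ x y : ↥(π.blocks.sup id),
      SameBlock π.blocks x y → Conn c x y) :
    ∃! σ : Finpartition π.blocks, IsNoncrossing (merge σ) ∧
      ∀ x y : ↥(π.blocks.sup id), Conn c x y ↔ SameBlock (merge σ) x y := by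
  classical
  -- Equality is added to make the relation reflexive on all finite sets. Transitivity passes from
  -- one element of the middle block to another by `hc`.
  let s : Setoid (Finset ℕ) :=
    { r := fun b b' => b = b' ∨ (b ∈ π.blocks ∧ b' ∈ π.blocks ∧
        ∃ x y : ↥(π.blocks.sup id), x.1 ∈ b ∧ y.1 ∈ b' ∧ Conn c x y)
      iseqv :=
        { refl := fun b => Or.inl rfl
          symm := by
            rintro b b' (rfl | ⟨hb, hb', x, y, hx, hy, h⟩)
            · exact Or.inl rfl
            · exact Or.inr ⟨hb', hb, y, x, hy, hx, h.symm⟩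
          trans := by
            rintro b b' b'' (rfl | ⟨hb, hb', x, y, hx, hy, h⟩) (rfl | ⟨hb₁, hb₂, z, t, hz, ht, h'⟩)
            · exact Or.inl rfl
            · exact Or.inr ⟨hb₁, hb₂, z, t, hz, ht, h'⟩
            · exact Or.inr ⟨hb, hb', x, y, hx, hy, h⟩
            · exact Or.inr ⟨hb, hb₂, x, t, hx, ht,
                (h.trans (hc y z ⟨b', hb', hy, hz⟩)).trans h'⟩ } }
  let σ : Finpartition π.blocks := Finpartition.ofSetSetoid s π.blocks
  have hσ : ∀ x y : ↥(π.blocks.sup id), Conn c x y ↔ SameBlock (merge σ) x y := by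
    intro x y
    obtain ⟨b, hb, hx⟩ := mem_sup_iff.1 x.2
    obtain ⟨b', hb', hy⟩ := mem_sup_iff.1 y.2
    rw [sameBlock_merge σ hb hb' hx hy, Finpartition.mem_part_ofSetSetoid_iff_rel]
    constructor
    · exact fun h => ⟨hb, hb', Or.inr ⟨hb, hb', x, y, hx, hy, h⟩⟩
    · rintro ⟨-, -, rfl | ⟨-, -, x', y', hx', hy', h⟩⟩
      · exact hc x y ⟨b, hb, hx, hy⟩
      · exact ((hc x x' ⟨b, hb, hx, hx'⟩).trans h).trans (hc y' y ⟨b', hb', hy', hy⟩)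
  refine ⟨σ, ⟨⟨?_, ?_, ?_⟩, hσ⟩, ?_⟩
  · intro _ hQ
    obtain ⟨P, hP, rfl⟩ := Finset.mem_image.1 hQ
    obtain ⟨b, hb⟩ := σ.nonempty_of_mem_parts hP
    obtain ⟨x, hx⟩ := π.noncrossing.nonempty_block b (σ.le hP hb)
    exact ⟨x, mem_sup_of_mem hb hx⟩
  · intro _ hQ _ hQ' hne
    obtain ⟨P, hP, rfl⟩ := Finset.mem_image.1 hQ
    obtain ⟨P', hP', rfl⟩ := Finset.mem_image.1 hQ'
    rw [Finset.disjoint_left]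
    intro x hx hx'
    obtain ⟨b, hb, hxb⟩ := mem_sup_iff.1 hx
    obtain ⟨b', hb', hxb'⟩ := mem_sup_iff.1 hx'
    obtain rfl := π.noncrossing.eq_of_mem (σ.le hP hb) (σ.le hP' hb') hxb hxb'
    exact hne (congrArg (fun P : Finset (Finset ℕ) => P.sup id)
      (σ.eq_of_mem_parts hP hP' hb hb'))
  · intro Q hQ Q' hQ' hne x hx z hz y hy t ht ⟨hxy, hyz, hzt⟩
    have hmem : ∀ R ∈ merge σ, ∀ u ∈ R, u ∈ π.blocks.sup id := fun R hR u hu =>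
      sup_merge σ ▸ mem_sup_of_mem hR hu
    obtain ⟨P, hP, rfl⟩ := Finset.mem_image.1 hQ
    obtain ⟨P', hP', rfl⟩ := Finset.mem_image.1 hQ'
    let X : ↥(π.blocks.sup id) := ⟨x, hmem _ hQ x hx⟩
    let Y : ↥(π.blocks.sup id) := ⟨y, hmem _ hQ' y hy⟩
    let Z : ↥(π.blocks.sup id) := ⟨z, hmem _ hQ z hz⟩
    let W : ↥(π.blocks.sup id) := ⟨t, hmem _ hQ' t ht⟩
    have hXY : X < Y := hxy
    have hYZ : Y < Z := hyz
    have hZW : Z < W := hzt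
    have h1 : Conn c X Z := (hσ X Z).2 ⟨_, hQ, hx, hz⟩
    have h2 : Conn c Y W := (hσ Y W).2 ⟨_, hQ', hy, ht⟩
    -- In a crossing x < y < z < t, the connection of x and z gives c x ≤ c y, and that of y and t
    -- gives c y ≤ c z = c x. No smaller colour occurs between x and y, so they are connected and
    -- the two classes coincide.
    have h3 : c X = c Y := by
      refine le_antisymm (h1.2 Y ?_) (h1.1 ▸ h2.2 Z ?_)
      · exact Set.mem_uIcc.2 (Or.inl ⟨hXY.le, hYZ.le⟩)
      · exact Set.mem_uIcc.2 (Or.inl ⟨hYZ.le, hZW.le⟩)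
    have h4 : Conn c X Y := by
      refine ⟨h3, fun u hu => h1.2 u ?_⟩
      rw [Set.uIcc_of_le hXY.le] at hu
      exact Set.mem_uIcc.2 (Or.inl ⟨hu.1, hu.2.trans hYZ.le⟩)
    obtain ⟨b, hb, hxb⟩ := mem_sup_iff.1 hx
    obtain ⟨b', hb', hyb⟩ := mem_sup_iff.1 hy
    have h5 := (sameBlock_merge σ (σ.le hP hb) (σ.le hP' hb') hxb hyb).1 ((hσ X Y).1 h4)
    rw [σ.part_eq_of_mem hP hb] at h5
    exact hne (congrArg (fun P : Finset (Finset ℕ) => P.sup id)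
      (σ.eq_of_mem_parts hP hP' h5 hb'))
  · rintro τ ⟨-, hτ⟩
    refine finpartition_eq_of_part fun b hb b' hb' => ?_
    obtain ⟨x, hx⟩ := π.noncrossing.nonempty_block b hb
    obtain ⟨y, hy⟩ := π.noncrossing.nonempty_block b' hb'
    rw [← sameBlock_merge τ hb hb' hx hy, ← sameBlock_merge σ hb hb' hx hy,
      ← hσ ⟨x, mem_sup_of_mem hb hx⟩ ⟨y, mem_sup_of_mem hb' hy⟩,
      ← hτ ⟨x, mem_sup_of_mem hb hx⟩ ⟨y, mem_sup_of_mem hb' hy⟩]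

/-! ### Colourings by a lexicographic product -/

open scoped Classical in
theorem card_eq_sum_merge {π : Partition} {E α : Type*} [Finite E] [LinearOrder α]
    (p : E → ↥(π.blocks.sup id) → α)
    (hp : ∀ e, ∀ x y : ↥(π.blocks.sup id), SameBlock π.blocks x y → Conn (p e) x y) :
    Nat.card E = ∑ σ ∈ (Finset.univ : Finset (Finpartition π.blocks)).filter
        fun σ => IsNoncrossing (merge σ),
      Nat.card {e // ∀ x y : ↥(π.blocks.sup id),
        Conn (p e) x y ↔ SameBlock (merge σ) x y} := by
  refine card_eq_sum_card _ (fun e σ => ∀ x y : ↥(π.blocks.sup id),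
        Conn (p e) x y ↔ SameBlock (merge σ) x y) fun e => ?_
  simpa using existsUnique_merge (p e) (hp e)

/-- The second coordinate is compared only where the first one ties. -/
theorem conn_lex {T α β : Type*} [LinearOrder T] [LinearOrder α] [LinearOrder β]
    (g : T → α) (h : T → β) (x y : T) :
    Conn (fun x => toLex (g x, h x)) x y ↔
      Conn g x y ∧ h x = h y ∧ ∀ z ∈ Set.uIcc x y, g z = g x → h x ≤ h z := by
  simp only [Conn, Prod.Lex.le_iff, ofLex_toLex, EmbeddingLike.apply_eq_iff_eq, Prod.mk.injEq]
  constructor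
  · rintro ⟨⟨hg, hh⟩, H⟩
    refine ⟨⟨hg, fun z hz => ?_⟩, hh, fun z hz hgz => ?_⟩
    · rcases H z hz with h1 | h1
      · exact h1.le
      · exact h1.1.le
    · rcases H z hz with h1 | h1
      · exact absurd h1 (by rw [hgz]; exact lt_irrefl _)
      · exact h1.2
  · rintro ⟨⟨hg, H⟩, hh, H'⟩
    refine ⟨⟨hg, hh⟩, fun z hz => ?_⟩
    rcases (H z hz).lt_or_eq with h1 | h1
    · exact Or.inl h1
    · exact Or.inr ⟨h1, H' z hz h1.symm⟩

theorem mem_sup_blocks_of_mem_part {π : Partition} {σ : Finpartition π.blocks}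
    {C : Finset (Finset ℕ)} (hC : C ∈ σ.parts) {x : ℕ} (hx : x ∈ C.sup id) :
    x ∈ π.blocks.sup id := by
  obtain ⟨b, hb, hx⟩ := mem_sup_iff.1 hx
  exact mem_sup_of_mem (σ.le hC hb) hx

theorem part_eq_of_mem_sup {π : Partition} {σ : Finpartition π.blocks}
    {C D : Finset (Finset ℕ)} (hC : C ∈ σ.parts) (hD : D ∈ σ.parts) {x : ℕ}
    (hx : x ∈ C.sup id) (hx' : x ∈ D.sup id) : C = D := by
  obtain ⟨b, hb, hxb⟩ := mem_sup_iff.1 hx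
  obtain ⟨d, hd, hxd⟩ := mem_sup_iff.1 hx'
  obtain rfl := π.noncrossing.eq_of_mem (σ.le hC hb) (σ.le hD hd) hxb hxd
  exact σ.eq_of_mem_parts hC hD hb hd

theorem mem_sup_iff_exists_part {π : Partition} (σ : Finpartition π.blocks) (x : ℕ) :
    x ∈ π.blocks.sup id ↔ ∃ C : {C // C ∈ σ.parts}, x ∈ C.1.sup id := by
  constructor
  · intro h
    obtain ⟨b, hb, hx⟩ := mem_sup_iff.1 h
    exact ⟨⟨_, σ.part_mem.2 hb⟩, mem_sup_of_mem (σ.mem_part hb) hx⟩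
  · rintro ⟨C, hx⟩
    exact mem_sup_blocks_of_mem_part C.2 hx

theorem sameBlock_part_iff {π : Partition} {σ : Finpartition π.blocks}
    {C : Finset (Finset ℕ)} (hC : C ∈ σ.parts) {x y : ℕ} (hx : x ∈ C.sup id) :
    SameBlock π.blocks x y ↔ SameBlock C x y := by
  constructor
  · rintro ⟨b, hb, hxb, hyb⟩
    obtain ⟨d, hd, hxd⟩ := mem_sup_iff.1 hx
    obtain rfl := π.noncrossing.eq_of_mem hb (σ.le hC hd) hxb hxd
    exact ⟨b, hd, hxb, hyb⟩
  · rintro ⟨b, hb, hxb, hyb⟩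
    exact ⟨b, σ.le hC hb, hxb, hyb⟩

theorem sameBlock_merge_iff_exists_part {π : Partition} {σ : Finpartition π.blocks} {x y : ℕ} :
    SameBlock (merge σ) x y ↔ ∃ C ∈ σ.parts, x ∈ C.sup id ∧ y ∈ C.sup id := by
  simp [SameBlock, merge]

theorem sameBlock_merge_of_sameBlock {π : Partition} (σ : Finpartition π.blocks) {x y : ℕ}
    (h : SameBlock π.blocks x y) : SameBlock (merge σ) x y := by
  obtain ⟨b, hb, hx, hy⟩ := h
  exact (sameBlock_merge σ hb hb hx hy).2 (σ.mem_part hb)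

/-- The conditions on h decouple over the classes of σ: if x and y lie in a class C, the elements
between them at which g ties with x are exactly those of C, so only the restriction of h to C
matters. -/
theorem conn_lex_iff_forall_part {π : Partition} {σ : Finpartition π.blocks} {α β : Type*}
    [LinearOrder α] [LinearOrder β] {g : ↥(π.blocks.sup id) → α}
    (hg : ∀ x y : ↥(π.blocks.sup id), Conn g x y ↔ SameBlock (merge σ) x y)
    (h : ↥(π.blocks.sup id) → β) :
    (∀ x y : ↥(π.blocks.sup id),
      Conn (fun x => toLex (g x, h x)) x y ↔ SameBlock π.blocks x y) ↔
    ∀ C : {C // C ∈ σ.parts}, ∀ x y : ↥(C.1.sup id),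
      Conn (fun x : ↥(C.1.sup id) => h ⟨x, mem_sup_blocks_of_mem_part C.2 x.2⟩) x y ↔
        SameBlock C x y := by
  have key : ∀ C : {C // C ∈ σ.parts}, ∀ x y : ↥(C.1.sup id),
      Conn (fun x : ↥(C.1.sup id) => h ⟨x, mem_sup_blocks_of_mem_part C.2 x.2⟩) x y ↔
      Conn (fun x => toLex (g x, h x)) ⟨x, mem_sup_blocks_of_mem_part C.2 x.2⟩
        ⟨y, mem_sup_blocks_of_mem_part C.2 y.2⟩ := by
    intro C x y
    have hxy : Conn g ⟨x, mem_sup_blocks_of_mem_part C.2 x.2⟩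
        ⟨y, mem_sup_blocks_of_mem_part C.2 y.2⟩ :=
      (hg _ _).2 (sameBlock_merge_iff_exists_part.2 ⟨C.1, C.2, x.2, y.2⟩)
    rw [conn_lex]
    refine ⟨fun H => ⟨hxy, H.1, fun z hz hzx => ?_⟩, fun H => ⟨H.2.1, fun z hz => ?_⟩⟩
    -- An element z between x and y with the first colour of x is itself connected to x by g, hence
    -- lies in C.
    · have hxz : Conn g ⟨x, mem_sup_blocks_of_mem_part C.2 x.2⟩ z :=
        ⟨hzx.symm, fun u hu => hxy.2 u (Set.uIcc_subset_uIcc_left hz hu)⟩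
      obtain ⟨D, hD, hxD, hzD⟩ := sameBlock_merge_iff_exists_part.1 ((hg _ _).1 hxz)
      obtain rfl := part_eq_of_mem_sup C.2 hD x.2 hxD
      refine H.2 ⟨z, hzD⟩ ?_
      rw [Set.mem_uIcc] at hz ⊢
      exact hz
    · refine H.2.2 ⟨z, mem_sup_blocks_of_mem_part C.2 z.2⟩ ?_ ?_
      · rw [Set.mem_uIcc] at hz ⊢
        exact hz
      · exact ((hg _ _).2 (sameBlock_merge_iff_exists_part.2 ⟨C.1, C.2, z.2, x.2⟩)).1
  constructor
  · intro H C x y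
    rw [key, H, sameBlock_part_iff C.2 x.2]
  · intro H x y
    constructor
    · intro hxy
      have hxy' := (hg x y).1 ((conn_lex g h x y).1 hxy).1
      obtain ⟨C, hC, hx, hy⟩ := sameBlock_merge_iff_exists_part.1 hxy'
      rw [sameBlock_part_iff hC hx]
      exact (H ⟨C, hC⟩ ⟨x, hx⟩ ⟨y, hy⟩).1 ((key ⟨C, hC⟩ ⟨x, hx⟩ ⟨y, hy⟩).2 hxy)
    · intro hxy
      obtain ⟨C, hC, hx, hy⟩ :=
        sameBlock_merge_iff_exists_part.1 (sameBlock_merge_of_sameBlock σ hxy)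
      rw [sameBlock_part_iff hC hx] at hxy
      exact (key ⟨C, hC⟩ ⟨x, hx⟩ ⟨y, hy⟩).1 ((H ⟨C, hC⟩ ⟨x, hx⟩ ⟨y, hy⟩).2 hxy)

theorem numColorings_merge {π : Partition} (σ : Finpartition π.blocks) (α : Type*)
    [LinearOrder α] : Nat.card {c : ↥(π.blocks.sup id) → α //
      ∀ x y : ↥(π.blocks.sup id), Conn c x y ↔ SameBlock (merge σ) x y} = numCol (merge σ) α :=
  numColorings_eq_numCol (sup_merge σ) α

theorem card_colorings_parts {π : Partition} (σ : Finpartition π.blocks) (β : Type*)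
    [LinearOrder β] :
    Nat.card {h : ↥(π.blocks.sup id) → β // ∀ C : {C // C ∈ σ.parts}, ∀ x y : ↥(C.1.sup id),
      Conn (fun x : ↥(C.1.sup id) => h ⟨x, mem_sup_blocks_of_mem_part C.2 x.2⟩) x y ↔
        SameBlock C x y} = ∏ C ∈ σ.parts, numCol C β := by
  rw [← Finset.prod_coe_sort]
  exact card_glue (π.blocks.sup id) (fun C : {C // C ∈ σ.parts} => C.1.sup id)
    (fun C D x hx hx' => Subtype.ext (part_eq_of_mem_sup C.2 D.2 hx hx'))
    (mem_sup_iff_exists_part σ)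
    (fun C d => ∀ x y : ↥(C.1.sup id), Conn d x y ↔ SameBlock C x y)

open scoped Classical in
-- Sort the colourings by the classes of their first coordinate. Those attached to σ are the pairs
-- of a colouring with classes `merge σ` and a family of colourings of the parts of σ.
theorem numCol_lex_prod (π : Partition) (α β : Type*) [LinearOrder α] [LinearOrder β] [Finite α]
    [Finite β] : numCol π.blocks (α ×ₗ β) =
      ∑ σ ∈ (Finset.univ : Finset (Finpartition π.blocks)).filter
        fun σ => IsNoncrossing (merge σ),
      numCol (merge σ) α * ∏ C ∈ σ.parts, numCol C β := by
  have hfst : ∀ c : ↥(π.blocks.sup id) → α ×ₗ β, ∀ x y, Conn c x y →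
      Conn (fun x => (ofLex (c x)).1) x y := fun c x y h =>
    ((conn_lex (fun x => (ofLex (c x)).1) (fun x => (ofLex (c x)).2) x y).1 h).1
  unfold numCol numColorings
  have : Finite (α ×ₗ β) := inferInstanceAs (Finite (α × β))
  rw [card_eq_sum_merge (fun c x => (ofLex (c.1 x)).1)
    (fun c x y hxy => hfst c.1 x y ((c.2 x y).2 hxy))]
  refine Finset.sum_congr rfl fun σ _ => ?_
  have h1 := numColorings_merge σ α
  have h2 := card_colorings_parts σ β
  unfold numCol numColorings at h1 h2
  rw [← h1, ← h2, ← Nat.card_prod]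
  symm
  refine Nat.card_congr (Equiv.ofBijective
    (fun p => ⟨⟨fun x => toLex (p.1.1 x, p.2.1 x),
      (conn_lex_iff_forall_part p.1.2 p.2.1).2 p.2.2⟩, p.1.2⟩) ⟨?_, ?_⟩)
  · rintro ⟨⟨g, hg⟩, ⟨h, hh⟩⟩ ⟨⟨g', hg'⟩, ⟨h', hh'⟩⟩ H
    have H' := fun x => congrArg (fun z => ofLex (z.1.1 x)) H
    simp only [ofLex_toLex, Prod.mk.injEq] at H'
    obtain rfl : g = g' := funext fun x => (H' x).1
    obtain rfl : h = h' := funext fun x => (H' x).2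
    rfl
  · rintro ⟨⟨c, hc⟩, hg⟩
    exact ⟨⟨⟨fun x => (ofLex (c x)).1, hg⟩, ⟨fun x => (ofLex (c x)).2,
      (conn_lex_iff_forall_part hg _).1 hc⟩⟩, rfl⟩

/-! ### Colourings by a lexicographic sum -/

open scoped Classical in
/-- The component of `x` in `S`. -/
noncomputable def component (S : Finset ℕ) (x : ℕ) : Finset ℕ :=
  S.filter fun y => ∀ z, min x y ≤ z → z ≤ max x y → z ∈ S

theorem mem_component {S : Finset ℕ} {x y : ℕ} :
    y ∈ component S x ↔ y ∈ S ∧ ∀ z ∈ Set.uIcc x y, z ∈ S := by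
  simp [component, Set.uIcc]

theorem mem_components {S C : Finset ℕ} :
    C ∈ components S ↔ ∃ x ∈ S, component S x = C := by
  simp [components, component]

theorem component_eq {S C : Finset ℕ} {x : ℕ} (hC : C ∈ components S) (hx : x ∈ C) :
    C = component S x := by
  obtain ⟨a, ha, rfl⟩ := mem_components.1 hC
  obtain ⟨hxS, hax⟩ := mem_component.1 hx
  ext y
  simp only [mem_component]
  refine and_congr_right fun _ => ⟨fun h z hz => ?_, fun h z hz => ?_⟩
  · rcases Set.uIcc_subset_uIcc_union_uIcc (b := a) hz with hz | hz
    · exact hax z (Set.uIcc_comm x a ▸ hz)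
    · exact h z hz
  · rcases Set.uIcc_subset_uIcc_union_uIcc (b := x) hz with hz | hz
    · exact hax z hz
    · exact h z hz

theorem mem_component_self {S : Finset ℕ} {x : ℕ} (hx : x ∈ S) : x ∈ component S x :=
  mem_component.2 ⟨hx, fun z hz => by simp at hz; exact hz ▸ hx⟩

theorem component_mem_components {S : Finset ℕ} {x : ℕ} (hx : x ∈ S) :
    component S x ∈ components S := mem_components.2 ⟨x, hx, rfl⟩

/-- In an ideal, a block lies in a single component of the union of the blocks. -/
theorem IsIdeal.subset_component {π : Partition} {J : Finset (Finset ℕ)} (hJ : IsIdeal π J)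
    {b : Finset ℕ} (hb : b ∈ J) {x : ℕ} (hx : x ∈ b) : b ⊆ component (J.sup id) x := by
  intro y hy
  refine mem_component.2 ⟨mem_sup_of_mem hb hy, fun z hz => ?_⟩
  obtain ⟨n, hn⟩ := π.ground
  have hx' : x ∈ Finset.Icc 1 n := hn ▸ mem_sup_of_mem (hJ.1 hb) hx
  have hy' : y ∈ Finset.Icc 1 n := hn ▸ mem_sup_of_mem (hJ.1 hb) hy
  rw [Set.mem_uIcc] at hz
  -- The ground set is a full interval, so z lies in some block of π; that block is nested in b and
  -- therefore belongs to J.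
  have hz' : z ∈ π.blocks.sup id := by
    rw [hn]
    simp only [Finset.mem_Icc] at hx' hy' ⊢
    omega
  obtain ⟨d, hd, hzd⟩ := mem_sup_iff.1 hz'
  refine mem_sup_of_mem (hJ.2 b hb d hd ?_) hzd
  rcases hz with hz | hz
  · exact π.noncrossing.nested (hJ.1 hb) hd hx hzd hy hz.1 hz.2
  · exact π.noncrossing.nested (hJ.1 hb) hd hy hzd hx hz.1 hz.2

theorem IsIdeal.sup_filter_component {π : Partition} {J : Finset (Finset ℕ)} (hJ : IsIdeal π J)
    {C : Finset ℕ} (hC : C ∈ components (J.sup id)) : (J.filter (· ⊆ C)).sup id = C := by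
  ext x
  simp only [mem_sup_iff, Finset.mem_filter]
  constructor
  · rintro ⟨b, ⟨-, hbC⟩, hx⟩
    exact hbC hx
  · intro hx
    have hCx := component_eq hC hx
    have hxJ : x ∈ J.sup id := (mem_component.1 (hCx ▸ hx)).1
    obtain ⟨b, hb, hxb⟩ := mem_sup_iff.1 hxJ
    exact ⟨b, ⟨hb, hCx ▸ hJ.subset_component hb hxb⟩, hxb⟩

/-- The elements of `U` are connected by `c` inside the interval partition `S`: all the integers
between them belong to `U`. -/
def HighConn {U : Finset ℕ} {β : Type*} [LinearOrder β] (c : U → β) (x y : U) : Prop :=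
  c x = c y ∧ ∀ z ∈ Set.uIcc x.1 y.1, ∃ h : z ∈ U, c x ≤ c ⟨z, h⟩

theorem mem_of_mem_filter_sup {J : Finset (Finset ℕ)} {C : Finset ℕ} {x : ℕ}
    (hx : x ∈ (J.filter (· ⊆ C)).sup id) : x ∈ J.sup id := by
  obtain ⟨b, hb, hxb⟩ := mem_sup_iff.1 hx
  exact mem_sup_of_mem (Finset.mem_filter.1 hb).1 hxb

/-- Elements related by `HighConn` have all the integers between them in the union of J, so they lie
in one component. Inside a component no integer is missing, and the relation is ordinary
connectedness. -/
theorem highConn_iff_forall_component {π : Partition} {J : Finset (Finset ℕ)} (hJ : IsIdeal π J)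
    {β : Type*} [LinearOrder β] (c : ↥(J.sup id) → β) :
    (∀ x y : ↥(J.sup id), HighConn c x y ↔ SameBlock J x y) ↔
    ∀ C : {C // C ∈ components (J.sup id)}, ∀ x y : ↥((J.filter (· ⊆ C.1)).sup id),
      Conn (fun x : ↥((J.filter (· ⊆ C.1)).sup id) => c ⟨x, mem_of_mem_filter_sup x.2⟩) x y ↔
        SameBlock (J.filter (· ⊆ C.1)) x y := by
  have key : ∀ C : {C // C ∈ components (J.sup id)},
      ∀ x y : ↥((J.filter (· ⊆ C.1)).sup id),
      Conn (fun x : ↥((J.filter (· ⊆ C.1)).sup id) => c ⟨x, mem_of_mem_filter_sup x.2⟩) x y ↔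
      HighConn c ⟨x, mem_of_mem_filter_sup x.2⟩ ⟨y, mem_of_mem_filter_sup y.2⟩ := by
    intro C x y
    have hsup := hJ.sup_filter_component C.2
    have hxC : x.1 ∈ C.1 := (Finset.ext_iff.1 hsup x.1).1 x.2
    have hyC : y.1 ∈ C.1 := (Finset.ext_iff.1 hsup y.1).1 y.2
    have hCx := component_eq C.2 hxC
    refine and_congr_right fun _ => ⟨fun H z hz => ?_, fun H z hz => ?_⟩
    · have hzx : ∀ u ∈ Set.uIcc x.1 y.1, u ∈ J.sup id := (mem_component.1 (hCx ▸ hyC)).2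
      have hzC : z ∈ C.1 := by
        rw [hCx, mem_component]
        exact ⟨hzx z hz, fun u hu => hzx u (Set.uIcc_subset_uIcc_left hz hu)⟩
      refine ⟨hzx z hz, H ⟨z, hsup.symm ▸ hzC⟩ ?_⟩
      rw [Set.mem_uIcc] at hz ⊢
      exact hz
    · obtain ⟨_, h⟩ := H z.1 (by rw [Set.mem_uIcc] at hz ⊢; exact hz)
      exact h
  have key' : ∀ C : {C // C ∈ components (J.sup id)}, ∀ x y : ℕ, x ∈ C.1 →
      (SameBlock (J.filter (· ⊆ C.1)) x y ↔ SameBlock J x y) := by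
    intro C x y hx
    constructor
    · rintro ⟨b, hb, h⟩
      exact ⟨b, (Finset.mem_filter.1 hb).1, h⟩
    · rintro ⟨b, hb, hxb, hyb⟩
      refine ⟨b, Finset.mem_filter.2 ⟨hb, ?_⟩, hxb, hyb⟩
      rw [component_eq C.2 hx]
      exact hJ.subset_component hb hxb
  constructor
  · intro H C x y
    rw [key, H, key' C x y ((Finset.ext_iff.1 (hJ.sup_filter_component C.2) x.1).1 x.2)]
  · intro H x y
    let C : {C // C ∈ components (J.sup id)} := ⟨_, component_mem_components x.2⟩
    have hsup := hJ.sup_filter_component C.2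
    have hx : x.1 ∈ C.1 := mem_component_self x.2
    have hmain : y.1 ∈ C.1 → (HighConn c x y ↔ SameBlock J x y) := by
      intro hy
      rw [← key' C x y hx]
      exact (key C ⟨x, hsup.symm ▸ hx⟩ ⟨y, hsup.symm ▸ hy⟩).symm.trans
        (H C ⟨x, hsup.symm ▸ hx⟩ ⟨y, hsup.symm ▸ hy⟩)
    constructor
    · intro h
      exact (hmain (mem_component.2 ⟨y.2, fun z hz => (h.2 z hz).1⟩)).1 h
    · intro h
      refine (hmain ?_).2 h
      obtain ⟨b, hb, hxb, hyb⟩ := h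
      exact hJ.subset_component hb hxb hyb

theorem card_colorings_components {π : Partition} {J : Finset (Finset ℕ)} (hJ : IsIdeal π J)
    (β : Type*) [LinearOrder β] :
    Nat.card {c : ↥(J.sup id) → β // ∀ x y : ↥(J.sup id), HighConn c x y ↔ SameBlock J x y} =
      ∏ C ∈ components (J.sup id), numCol (J.filter (· ⊆ C)) β := by
  rw [← Finset.prod_coe_sort]
  refine (Nat.card_congr (Equiv.subtypeEquivRight
    (highConn_iff_forall_component (β := β) hJ))).trans ?_
  refine card_glue (J.sup id)
    (fun C : {C // C ∈ components (J.sup id)} => (J.filter (· ⊆ C.1)).sup id) ?_ ?_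
    (fun C d => ∀ x y : ↥((J.filter (· ⊆ C.1)).sup id),
      Conn d x y ↔ SameBlock (J.filter (· ⊆ C.1)) x y)
  · intro C D x hC hD
    rw [hJ.sup_filter_component C.2] at hC
    rw [hJ.sup_filter_component D.2] at hD
    exact Subtype.ext ((component_eq C.2 hC).trans (component_eq D.2 hD).symm)
  · intro x
    refine ⟨fun hx => ⟨⟨_, component_mem_components hx⟩, ?_⟩, fun ⟨C, hx⟩ =>
      mem_of_mem_filter_sup hx⟩
    rw [hJ.sup_filter_component (component_mem_components hx)]
    exact mem_component_self hx

theorem mem_sup_sdiff {π : Partition} {J : Finset (Finset ℕ)} (hJ : J ⊆ π.blocks) {x : ℕ} :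
    x ∈ (π.blocks \ J).sup id ↔ x ∈ π.blocks.sup id ∧ x ∉ J.sup id := by
  simp only [mem_sup_iff, Finset.mem_sdiff]
  constructor
  · rintro ⟨b, ⟨hb, hbJ⟩, hx⟩
    refine ⟨⟨b, hb, hx⟩, ?_⟩
    rintro ⟨d, hd, hxd⟩
    exact hbJ (π.noncrossing.eq_of_mem hb (hJ hd) hx hxd ▸ hd)
  · rintro ⟨⟨b, hb, hx⟩, h⟩
    exact ⟨b, ⟨hb, fun hbJ => h ⟨b, hbJ, hx⟩⟩, hx⟩

theorem sup_mono_of_subset {B J : Finset (Finset ℕ)} (hJ : J ⊆ B) {x : ℕ} (hx : x ∈ J.sup id) :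
    x ∈ B.sup id := by
  obtain ⟨b, hb, hx⟩ := mem_sup_iff.1 hx
  exact mem_sup_of_mem (hJ hb) hx

/-! ### Splitting a colouring into lower and upper colours -/

section Glue

variable {π : Partition} {J : Finset (Finset ℕ)} {α β : Type*}

/-- The colouring with lower colours outside `J` and upper colours on `J`. -/
noncomputable def glue (hJ : J ⊆ π.blocks) (c₁ : ↥((π.blocks \ J).sup id) → α)
    (c₂ : ↥(J.sup id) → β) (x : ↥(π.blocks.sup id)) : α ⊕ₗ β :=
  if h : x.1 ∈ J.sup id then toLex (Sum.inr (c₂ ⟨x, h⟩))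
  else toLex (Sum.inl (c₁ ⟨x, (mem_sup_sdiff hJ).2 ⟨x.2, h⟩⟩))

theorem glue_low (hJ : J ⊆ π.blocks) (c₁ : ↥((π.blocks \ J).sup id) → α)
    (c₂ : ↥(J.sup id) → β) (x : ↥((π.blocks \ J).sup id)) (hx : x.1 ∈ π.blocks.sup id) :
    glue hJ c₁ c₂ ⟨x, hx⟩ = toLex (Sum.inl (c₁ x)) :=
  dif_neg ((mem_sup_sdiff hJ).1 x.2).2

theorem glue_high (hJ : J ⊆ π.blocks) (c₁ : ↥((π.blocks \ J).sup id) → α)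
    (c₂ : ↥(J.sup id) → β) (x : ↥(J.sup id)) (hx : x.1 ∈ π.blocks.sup id) :
    glue hJ c₁ c₂ ⟨x, hx⟩ = toLex (Sum.inr (c₂ x)) :=
  dif_pos x.2

variable [LinearOrder α] [LinearOrder β]

/-- Elements with upper colours never separate elements with lower colours. -/
theorem conn_glue_low (hJ : J ⊆ π.blocks) (c₁ : ↥((π.blocks \ J).sup id) → α)
    (c₂ : ↥(J.sup id) → β) (x y : ↥((π.blocks \ J).sup id)) (hx : x.1 ∈ π.blocks.sup id)
    (hy : y.1 ∈ π.blocks.sup id) :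
    Conn (glue hJ c₁ c₂) ⟨x, hx⟩ ⟨y, hy⟩ ↔ Conn c₁ x y := by
  simp only [Conn, glue_low, EmbeddingLike.apply_eq_iff_eq, Sum.inl.injEq]
  refine and_congr_right fun _ => ⟨fun H z hz => ?_, fun H z hz => ?_⟩
  · have hzB := ((mem_sup_sdiff hJ).1 z.2).1
    have := H ⟨z, hzB⟩ (by rw [Set.mem_uIcc] at hz ⊢; exact hz)
    rwa [glue_low, Sum.Lex.inl_le_inl_iff] at this
  · by_cases hzJ : z.1 ∈ J.sup id
    · rw [glue_high hJ c₁ c₂ ⟨z, hzJ⟩ z.2]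
      exact Sum.Lex.inl_le_inr _ _
    · have hzW := (mem_sup_sdiff hJ).2 ⟨z.2, hzJ⟩
      rw [glue_low hJ c₁ c₂ ⟨z, hzW⟩ z.2, Sum.Lex.inl_le_inl_iff]
      exact H ⟨z, hzW⟩ (by rw [Set.mem_uIcc] at hz ⊢; exact hz)

/-- Any element outside J lying between x and y has a lower colour and separates them. As the ground
set is an interval, every integer between x and y is a possible obstruction. -/
theorem conn_glue_high (hJ : J ⊆ π.blocks) (c₁ : ↥((π.blocks \ J).sup id) → α)
    (c₂ : ↥(J.sup id) → β) (x y : ↥(J.sup id)) (hx : x.1 ∈ π.blocks.sup id)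
    (hy : y.1 ∈ π.blocks.sup id) :
    Conn (glue hJ c₁ c₂) ⟨x, hx⟩ ⟨y, hy⟩ ↔ HighConn c₂ x y := by
  simp only [Conn, HighConn, glue_high, EmbeddingLike.apply_eq_iff_eq, Sum.inr.injEq]
  refine and_congr_right fun _ => ⟨fun H z hz => ?_, fun H z hz => ?_⟩
  · obtain ⟨n, hn⟩ := π.ground
    have hzB : z ∈ π.blocks.sup id := by
      rw [hn] at hx hy ⊢
      rw [Set.mem_uIcc] at hz
      simp only [Finset.mem_Icc] at hx hy ⊢
      omega
    have hle := H ⟨z, hzB⟩ (by rw [Set.mem_uIcc] at hz ⊢; exact hz)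
    by_cases hzJ : z ∈ J.sup id
    · rw [glue_high hJ c₁ c₂ ⟨z, hzJ⟩ hzB, Sum.Lex.inr_le_inr_iff] at hle
      exact ⟨hzJ, hle⟩
    · rw [glue_low hJ c₁ c₂ ⟨z, (mem_sup_sdiff hJ).2 ⟨hzB, hzJ⟩⟩ hzB] at hle
      exact absurd hle Sum.Lex.not_inr_le_inl
  · obtain ⟨hzJ, hle⟩ := H z.1 (by rw [Set.mem_uIcc] at hz ⊢; exact hz)
    rw [glue_high hJ c₁ c₂ ⟨z, hzJ⟩ z.2, Sum.Lex.inr_le_inr_iff]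
    exact hle

theorem conn_glue_iff (hJ : J ⊆ π.blocks) (c₁ : ↥((π.blocks \ J).sup id) → α)
    (c₂ : ↥(J.sup id) → β) :
    (∀ x y : ↥(π.blocks.sup id), Conn (glue hJ c₁ c₂) x y ↔ SameBlock π.blocks x y) ↔
    (∀ x y : ↥((π.blocks \ J).sup id), Conn c₁ x y ↔ SameBlock (π.blocks \ J) x y) ∧
      ∀ x y : ↥(J.sup id), HighConn c₂ x y ↔ SameBlock J x y := by
  have hlow : ∀ {x y : ℕ}, x ∈ (π.blocks \ J).sup id →
      (SameBlock π.blocks x y ↔ SameBlock (π.blocks \ J) x y) := by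
    intro x y hx
    constructor
    · rintro ⟨b, hb, hxb, hyb⟩
      exact ⟨b, Finset.mem_sdiff.2 ⟨hb, fun hbJ => ((mem_sup_sdiff hJ).1 hx).2
        (mem_sup_of_mem hbJ hxb)⟩, hxb, hyb⟩
    · rintro ⟨b, hb, h⟩
      exact ⟨b, (Finset.mem_sdiff.1 hb).1, h⟩
  have hhigh : ∀ {x y : ℕ}, x ∈ J.sup id → (SameBlock π.blocks x y ↔ SameBlock J x y) := by
    intro x y hx
    constructor
    · rintro ⟨b, hb, hxb, hyb⟩
      obtain ⟨d, hd, hxd⟩ := mem_sup_iff.1 hx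
      obtain rfl := π.noncrossing.eq_of_mem hb (hJ hd) hxb hxd
      exact ⟨b, hd, hxb, hyb⟩
    · rintro ⟨b, hb, h⟩
      exact ⟨b, hJ hb, h⟩
  constructor
  · intro H
    refine ⟨fun x y => ?_, fun x y => ?_⟩
    · rw [← hlow x.2, ← conn_glue_low hJ c₁ c₂ x y ((mem_sup_sdiff hJ).1 x.2).1
        ((mem_sup_sdiff hJ).1 y.2).1]
      exact H _ _
    · rw [← hhigh x.2, ← conn_glue_high hJ c₁ c₂ x y (sup_mono_of_subset hJ x.2)
        (sup_mono_of_subset hJ y.2)]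
      exact H _ _
  · rintro ⟨H₁, H₂⟩ x y
    by_cases hx : x.1 ∈ J.sup id
    · rw [hhigh hx]
      by_cases hy : y.1 ∈ J.sup id
      · exact (conn_glue_high hJ c₁ c₂ ⟨x, hx⟩ ⟨y, hy⟩ x.2 y.2).trans (H₂ ⟨x, hx⟩ ⟨y, hy⟩)
      · refine iff_of_false (fun h => ?_) fun ⟨b, hb, _, hyb⟩ => hy (mem_sup_of_mem hb hyb)
        have := h.1
        rw [glue_high hJ c₁ c₂ ⟨x, hx⟩ x.2,
          glue_low hJ c₁ c₂ ⟨y, (mem_sup_sdiff hJ).2 ⟨y.2, hy⟩⟩ y.2] at this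
        simp at this
    · have hx' := (mem_sup_sdiff hJ).2 ⟨x.2, hx⟩
      rw [hlow hx']
      by_cases hy : y.1 ∈ J.sup id
      · refine iff_of_false (fun h => ?_) fun ⟨b, hb, _, hyb⟩ =>
          ((mem_sup_sdiff hJ).1 (mem_sup_of_mem hb hyb)).2 hy
        have := h.1
        rw [glue_low hJ c₁ c₂ ⟨x, hx'⟩ x.2, glue_high hJ c₁ c₂ ⟨y, hy⟩ y.2] at this
        simp at this
      · exact (conn_glue_low hJ c₁ c₂ ⟨x, hx'⟩ ⟨y, (mem_sup_sdiff hJ).2 ⟨y.2, hy⟩⟩ x.2 y.2).trans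
          (H₁ ⟨x, hx'⟩ ⟨y, (mem_sup_sdiff hJ).2 ⟨y.2, hy⟩⟩)

/-- The blocks with upper colours form an ideal. -/
theorem existsUnique_ideal (c : ↥(π.blocks.sup id) → α ⊕ₗ β)
    (hc : ∀ x y : ↥(π.blocks.sup id), Conn c x y ↔ SameBlock π.blocks x y) :
    ∃! J : Finset (Finset ℕ), IsIdeal π J ∧
      ∀ x : ↥(π.blocks.sup id), x.1 ∈ J.sup id ↔ (ofLex (c x)).isRight := by
  classical
  let J := π.blocks.filter fun b => ∃ x : ↥(π.blocks.sup id), x.1 ∈ b ∧ (ofLex (c x)).isRight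
  have hJ : J ⊆ π.blocks := Finset.filter_subset _ _
  have hmem : ∀ x : ↥(π.blocks.sup id), x.1 ∈ J.sup id ↔ (ofLex (c x)).isRight := by
    intro x
    constructor
    · intro hx
      obtain ⟨b, hb, hxb⟩ := mem_sup_iff.1 hx
      obtain ⟨hb, y, hyb, hy⟩ := Finset.mem_filter.1 hb
      rwa [((hc x y).2 ⟨b, hb, hxb, hyb⟩).1]
    · intro hx
      obtain ⟨b, hb, hxb⟩ := mem_sup_iff.1 x.2
      exact mem_sup_of_mem (Finset.mem_filter.2 ⟨hb, x, hxb, hx⟩) hxb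
  refine ⟨J, ⟨⟨hJ, fun b hb b' hb' hbb => ?_⟩, hmem⟩, ?_⟩
  · obtain ⟨hb, u, hub, hu⟩ := Finset.mem_filter.1 hb
    obtain ⟨y, hy⟩ := π.noncrossing.nonempty_block b' hb'
    obtain ⟨⟨x, hx, hxy⟩, ⟨z, hz, hyz⟩⟩ := hbb y hy
    let X : ↥(π.blocks.sup id) := ⟨x, mem_sup_of_mem hb hx⟩
    let Y : ↥(π.blocks.sup id) := ⟨y, mem_sup_of_mem hb' hy⟩
    let Z : ↥(π.blocks.sup id) := ⟨z, mem_sup_of_mem hb hz⟩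
    refine Finset.mem_filter.2 ⟨hb', Y, hy, ?_⟩
    -- Y lies between two connected elements of b, so its colour is at least that of b, which is an
    -- upper one.
    have h1 : c X ≤ c Y := ((hc X Z).2 ⟨b, hb, hx, hz⟩).2 Y (Set.mem_uIcc.2 (Or.inl ⟨hxy, hyz⟩))
    rw [((hc X u).2 ⟨b, hb, hx, hub⟩).1] at h1
    obtain ⟨v, hv⟩ := Sum.isRight_iff.1 hu
    rcases hY : ofLex (c Y) with a | a
    · rw [← toLex_ofLex (c u), ← toLex_ofLex (c Y), hv, hY] at h1
      exact absurd h1 Sum.Lex.not_inr_le_inl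
    · rfl
  · rintro J' ⟨hJ', hmem'⟩
    -- A set of blocks is determined by the union of its members, since distinct blocks are
    -- disjoint.
    have hsub : ∀ J₁ J₂ : Finset (Finset ℕ), J₁ ⊆ π.blocks → J₂ ⊆ π.blocks →
        (∀ x : ↥(π.blocks.sup id), x.1 ∈ J₁.sup id → x.1 ∈ J₂.sup id) → J₁ ⊆ J₂ := by
      intro J₁ J₂ h₁ h₂ h b hb
      obtain ⟨x, hx⟩ := π.noncrossing.nonempty_block b (h₁ hb)
      obtain ⟨d, hd, hxd⟩ := mem_sup_iff.1
        (h ⟨x, mem_sup_of_mem (h₁ hb) hx⟩ (mem_sup_of_mem hb hx))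
      exact π.noncrossing.eq_of_mem (h₂ hd) (h₁ hb) hxd hx ▸ hd
    exact Finset.Subset.antisymm
      (hsub _ _ hJ'.1 hJ fun x hx => (hmem x).2 ((hmem' x).1 hx))
      (hsub _ _ hJ hJ'.1 fun x hx => (hmem' x).2 ((hmem x).1 hx))

end Glue

open scoped Classical in
-- Sort the colourings by their ideal of upper blocks. For a given J, the lower and the upper parts
-- are chosen independently, and the upper part splits over the components of J.
theorem numCol_lex_sum (π : Partition) (α β : Type*) [LinearOrder α] [LinearOrder β] [Finite α]
    [Finite β] : numCol π.blocks (α ⊕ₗ β) =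
      ∑ J ∈ π.blocks.powerset.filter (IsIdeal π),
      numCol (π.blocks \ J) α * ∏ C ∈ components (J.sup id), numCol (J.filter (· ⊆ C)) β := by
  unfold numCol numColorings
  have : Finite (α ⊕ₗ β) := inferInstanceAs (Finite (α ⊕ β))
  rw [card_eq_sum_card (π.blocks.powerset.filter (IsIdeal π)) (fun c J =>
    ∀ x : ↥(π.blocks.sup id), x.1 ∈ J.sup id ↔ (ofLex (c.1 x)).isRight)]
  swap
  · intro c
    have hiff : ∀ J, J ∈ π.blocks.powerset.filter (IsIdeal π) ↔ IsIdeal π J := fun J => by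
      rw [Finset.mem_filter, Finset.mem_powerset]
      exact ⟨fun h => h.2, fun h => ⟨h.1, h⟩⟩
    simpa only [hiff] using existsUnique_ideal c.1 c.2
  refine Finset.sum_congr rfl fun J hJ => ?_
  have hJ : IsIdeal π J := (Finset.mem_filter.1 hJ).2
  have h2 := card_colorings_components hJ β
  unfold numCol numColorings at h2
  rw [← h2, ← Nat.card_prod]
  symm
  refine Nat.card_congr (Equiv.ofBijective
    (fun p => ⟨⟨glue hJ.1 p.1.1 p.2.1, (conn_glue_iff hJ.1 p.1.1 p.2.1).2 ⟨p.1.2, p.2.2⟩⟩,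
      fun x => ?_⟩) ⟨?_, ?_⟩)
  · by_cases hx : x.1 ∈ J.sup id
    · simp [glue, hx]
    · simp [glue, hx]
  · rintro ⟨⟨g, hg⟩, ⟨h, hh⟩⟩ ⟨⟨g', hg'⟩, ⟨h', hh'⟩⟩ H
    have H' := fun x => congrArg (fun z => z.1.1 x) H
    simp only at H'
    obtain rfl : g = g' := by
      funext x
      have := H' ⟨x, ((mem_sup_sdiff hJ.1).1 x.2).1⟩
      simpa [glue_low] using this
    obtain rfl : h = h' := by
      funext x
      have := H' ⟨x, sup_mono_of_subset hJ.1 x.2⟩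
      simpa [glue_high] using this
    rfl
  · rintro ⟨⟨c, hc⟩, hg⟩
    simp only at hg
    have hlow : ∀ x : ↥((π.blocks \ J).sup id), ∃ a,
        c ⟨x, ((mem_sup_sdiff hJ.1).1 x.2).1⟩ = toLex (Sum.inl a) := by
      intro x
      have hx := ((mem_sup_sdiff hJ.1).1 x.2).2
      rcases h : ofLex (c ⟨x, ((mem_sup_sdiff hJ.1).1 x.2).1⟩) with a | a
      · exact ⟨a, by rw [← h, toLex_ofLex]⟩
      · exact absurd ((hg _).2 (by rw [h]; rfl)) hx
    have hhigh : ∀ x : ↥(J.sup id), ∃ a,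
        c ⟨x, sup_mono_of_subset hJ.1 x.2⟩ = toLex (Sum.inr a) := by
      intro x
      obtain ⟨a, ha⟩ := Sum.isRight_iff.1 ((hg ⟨x, sup_mono_of_subset hJ.1 x.2⟩).1 x.2)
      exact ⟨a, by rw [← ha, toLex_ofLex]⟩
    choose g hg' using hlow
    choose h hh' using hhigh
    have hglue : glue hJ.1 g h = c := by
      funext x
      by_cases hx : x.1 ∈ J.sup id
      · rw [glue_high hJ.1 g h ⟨x, hx⟩ x.2]
        exact (hh' ⟨x, hx⟩).symm
      · have hx' := (mem_sup_sdiff hJ.1).2 ⟨x.2, hx⟩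
        rw [glue_low hJ.1 g h ⟨x, hx'⟩ x.2]
        exact (hg' ⟨x, hx'⟩).symm
    have hc' := (conn_glue_iff hJ.1 g h).1 (by rw [hglue]; exact hc)
    exact ⟨⟨⟨g, hc'.1⟩, ⟨h, hc'.2⟩⟩, Subtype.ext (Subtype.ext hglue)⟩

/-! ### The double bialgebra morphism -/

section Morphism

variable {K : Type*} [Field K]

/-- The algebra morphism sending a noncrossing partition to the polynomial counting the
colourings whose connectedness classes are its blocks. -/
noncomputable def colorHom (K : Type*) [Field K] : Alg K →ₐ[K] K[X] :=
  MvPolynomial.aeval fun π =>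
    coloringPoly K ↥(π.blocks.sup id) (fun x y => SameBlock π.blocks x y)

theorem gen_of_isNoncrossing {B : Finset (Finset ℕ)} (h : B.Nonempty) (hB : IsNoncrossing B) :
    gen K B = MvPolynomial.X (stdPartition B h hB) := by
  rw [gen, dif_pos ⟨h, hB⟩]

theorem eval_colorHom_X [CharZero K] (π : Partition) (n : ℕ) :
    (colorHom K (MvPolynomial.X π)).eval (n : K) = (numCol π.blocks (Fin n) : K) := by
  rw [colorHom, MvPolynomial.aeval_X, eval_coloringPoly]
  rfl

theorem eval_colorHom_gen [CharZero K] {B : Finset (Finset ℕ)} (hB : IsNoncrossing B) (n : ℕ) :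
    (colorHom K (gen K B)).eval (n : K) = (numCol B (Fin n) : K) := by
  rcases B.eq_empty_or_nonempty with rfl | h
  · rw [numCol_empty, gen, dif_neg (by simp)]
    simp
  · rw [gen_of_isNoncrossing h hB, eval_colorHom_X, ← numCol_std B]
    rfl

theorem numCol_fin_add (B : Finset (Finset ℕ)) (m n : ℕ) :
    numCol B (Fin (m + n)) = numCol B (Fin m ⊕ₗ Fin n) :=
  numCol_congr B (Fintype.orderIsoFinOfCardEq (Fin m ⊕ₗ Fin n)
    ((Fintype.card_congr toLex.symm).trans (by simp)))

theorem numCol_fin_mul (B : Finset (Finset ℕ)) (m n : ℕ) :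
    numCol B (Fin (m * n)) = numCol B (Fin m ×ₗ Fin n) :=
  numCol_congr B (Fintype.orderIsoFinOfCardEq (Fin m ×ₗ Fin n)
    ((Fintype.card_congr toLex.symm).trans (by simp)))

/-- Evaluated at (m, n), the identity is the count of colourings by m + n colours, seen as the
lexicographic sum of m and n colours. -/
theorem colorHom_map_coprod [CharZero K] : (polyCoprod K).comp (colorHom K) =
    (Algebra.TensorProduct.map (colorHom K) (colorHom K)).comp (coprod K) := by
  classical
  refine MvPolynomial.algHom_ext fun π => tensor_ext_of_eval fun m n => ?_
  rw [AlgHom.comp_apply, evalTensor_polyCoprod, ← Nat.cast_add, eval_colorHom_X, numCol_fin_add,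
    numCol_lex_sum, AlgHom.comp_apply, coprod, MvPolynomial.aeval_X, map_sum, map_sum]
  push_cast
  refine Finset.sum_congr (by congr!) fun J hJ => ?_
  rw [Algebra.TensorProduct.map_tmul, evalTensor_tmul,
    eval_colorHom_gen (π.noncrossing.mono Finset.sdiff_subset), cut, map_prod,
    Polynomial.eval_prod]
  congr 1
  refine Finset.prod_congr rfl fun C _ => ?_
  rw [eval_colorHom_gen]
  refine π.noncrossing.mono ((Finset.filter_subset _ _).trans ?_)
  exact Finset.mem_powerset.1 (Finset.mem_filter.1 hJ).1

open scoped Classical in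
theorem eval_act_X [CharZero K] (π : Partition) (m : ℕ) (χ : Alg K →ₐ[K] K) :
    (act (colorHom K) χ (MvPolynomial.X π)).eval (m : K) =
      ∑ σ ∈ (Finset.univ : Finset (Finpartition π.blocks)).filter
        fun σ => IsNoncrossing (merge σ),
      (numCol (merge σ) (Fin m) : K) * ∏ C ∈ σ.parts, χ (gen K C) := by
  classical
  rw [act, AlgHom.comp_apply, deltaCoprod, MvPolynomial.aeval_X, map_sum,
    Polynomial.eval_finsetSum]
  refine Finset.sum_congr (by congr!) fun σ hσ => ?_
  rw [← eval_colorHom_gen (Finset.mem_filter.1 hσ).2]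
  simp [mul_comm]

/-- Evaluated at (m, n), the identity is the count of colourings by mn colours, seen as a
lexicographic product. -/
theorem colorHom_map_delta [CharZero K] : (polyDelta K).comp (colorHom K) =
    (Algebra.TensorProduct.map (colorHom K) (colorHom K)).comp (deltaCoprod K) := by
  classical
  refine MvPolynomial.algHom_ext fun π => tensor_ext_of_eval fun m n => ?_
  rw [AlgHom.comp_apply, evalTensor_polyDelta, ← Nat.cast_mul, eval_colorHom_X, numCol_fin_mul,
    numCol_lex_prod, AlgHom.comp_apply, deltaCoprod, MvPolynomial.aeval_X, map_sum, map_sum]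
  push_cast
  refine Finset.sum_congr (by congr!) fun σ hσ => ?_
  rw [Algebra.TensorProduct.map_tmul, evalTensor_tmul,
    eval_colorHom_gen (Finset.mem_filter.1 hσ).2, map_prod, Polynomial.eval_prod]
  congr 1
  refine Finset.prod_congr rfl fun C hC => ?_
  rw [eval_colorHom_gen (π.noncrossing.mono (σ.le hC))]

theorem exists_mem_block (π : Partition) : ∃ b ∈ π.blocks, ∃ x, x ∈ b := by
  obtain ⟨b, hb⟩ := π.nonempty
  exact ⟨b, hb, π.noncrossing.nonempty_block b hb⟩

theorem numCol_fin_zero (π : Partition) : numCol π.blocks (Fin 0) = 0 := by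
  obtain ⟨b, hb, x, hx⟩ := exists_mem_block π
  unfold numCol numColorings
  have : IsEmpty {c : ↥(π.blocks.sup id) → Fin 0 //
      ∀ x y, Conn c x y ↔ SameBlock π.blocks x y} :=
    ⟨fun c => (c.1 ⟨x, mem_sup_of_mem hb hx⟩).elim0⟩
  exact Nat.card_of_isEmpty

/-- With a single colour all elements are connected, so there must be exactly one block. -/
theorem numCol_fin_one (π : Partition) :
    numCol π.blocks (Fin 1) = if π.blocks.card = 1 then 1 else 0 := by
  have hconn : ∀ (c : ↥(π.blocks.sup id) → Fin 1) x y, Conn c x y := fun c x y =>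
    ⟨Subsingleton.elim _ _, fun z _ => (Subsingleton.elim _ _ : c x = c z).le⟩
  unfold numCol numColorings
  split_ifs with h
  · obtain ⟨b, hb⟩ := Finset.card_eq_one.1 h
    have : Unique {c : ↥(π.blocks.sup id) → Fin 1 //
        ∀ x y, Conn c x y ↔ SameBlock π.blocks x y} :=
      { default := ⟨fun _ => 0, fun x y => iff_of_true (hconn _ x y) ⟨b, by simp [hb], by
          have hx := x.2
          have hy := y.2
          simp only [hb, Finset.sup_singleton, id] at hx hy
          exact ⟨hx, hy⟩⟩⟩
        uniq := fun c => Subsingleton.elim _ _ }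
    exact Nat.card_unique
  · have : IsEmpty {c : ↥(π.blocks.sup id) → Fin 1 //
        ∀ x y, Conn c x y ↔ SameBlock π.blocks x y} := by
      refine ⟨fun c => h ?_⟩
      obtain ⟨b, hb, x, hx⟩ := exists_mem_block π
      refine Finset.card_eq_one.2 ⟨b, Finset.eq_singleton_iff_unique_mem.2 ⟨hb, fun d hd => ?_⟩⟩
      obtain ⟨y, hy⟩ := π.noncrossing.nonempty_block d hd
      exact (π.noncrossing.sameBlock_iff hd hb hy hx).1
        ((c.2 ⟨y, mem_sup_of_mem hd hy⟩ ⟨x, mem_sup_of_mem hb hx⟩).1 (hconn _ _ _))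
    exact Nat.card_of_isEmpty

theorem isDoubleBialgHom_colorHom [CharZero K] : IsDoubleBialgHom (colorHom K) where
  map_coprod := colorHom_map_coprod
  map_delta := colorHom_map_delta
  map_counit := by
    have : (Polynomial.aeval (0 : K)).comp (colorHom K) = counit K := by
      refine MvPolynomial.algHom_ext fun π => ?_
      have := eval_colorHom_X (K := K) π 0
      rw [numCol_fin_zero] at this
      rw [AlgHom.comp_apply, Polynomial.coe_aeval_eq_eval, counit, MvPolynomial.aeval_X]
      simpa using this
    intro x
    simpa [Polynomial.coe_aeval_eq_eval] using DFunLike.congr_fun this x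
  map_deltaCounit := by
    have : (Polynomial.aeval (1 : K)).comp (colorHom K) = deltaCounit K := by
      refine MvPolynomial.algHom_ext fun π => ?_
      have := eval_colorHom_X (K := K) π 1
      rw [numCol_fin_one] at this
      rw [AlgHom.comp_apply, Polynomial.coe_aeval_eq_eval, deltaCounit, MvPolynomial.aeval_X]
      simpa using this
    intro x
    simpa [Polynomial.coe_aeval_eq_eval] using DFunLike.congr_fun this x

/-! ### Uniqueness of the double bialgebra morphism -/

theorem evalTensor_map (φ : Alg K →ₐ[K] K[X]) (a b : K) :
    (evalTensor a b).comp (Algebra.TensorProduct.map φ φ) =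
      (Algebra.TensorProduct.lmul' K).comp
        (Algebra.TensorProduct.map ((Polynomial.aeval a).comp φ) ((Polynomial.aeval b).comp φ)) := by
  ext <;> simp [evalTensor]

/-- By compatibility with Δ, evaluation at n + 1 is the convolution of the evaluations at n and at
1. The counits fix the evaluations at 0 and at 1, so induction fixes all of them. -/
theorem IsDoubleBialgHom.unique [CharZero K] {φ ψ : Alg K →ₐ[K] K[X]} (hφ : IsDoubleBialgHom φ)
    (hψ : IsDoubleBialgHom ψ) : φ = ψ := by
  have hadd : ∀ {φ : Alg K →ₐ[K] K[X]}, IsDoubleBialgHom φ → ∀ a b : K,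
      (Polynomial.aeval (a + b)).comp φ = ((Algebra.TensorProduct.lmul' K).comp
        (Algebra.TensorProduct.map ((Polynomial.aeval a).comp φ)
          ((Polynomial.aeval b).comp φ))).comp (coprod K) := by
    intro φ hφ a b
    rw [← evalTensor_map, AlgHom.comp_assoc, ← hφ.map_coprod]
    ext1 x
    simp only [AlgHom.comp_apply, evalTensor_polyCoprod, Polynomial.coe_aeval_eq_eval]
  have hone : (Polynomial.aeval (1 : K)).comp φ = (Polynomial.aeval (1 : K)).comp ψ := by
    refine AlgHom.ext fun x => ?_
    simp only [AlgHom.comp_apply, Polynomial.coe_aeval_eq_eval]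
    rw [hφ.map_deltaCounit, hψ.map_deltaCounit]
  have hall : ∀ n : ℕ, (Polynomial.aeval (n : K)).comp φ = (Polynomial.aeval (n : K)).comp ψ := by
    intro n
    induction n with
    | zero =>
      refine AlgHom.ext fun x => ?_
      simp only [AlgHom.comp_apply, Polynomial.coe_aeval_eq_eval, Nat.cast_zero]
      rw [hφ.map_counit, hψ.map_counit]
    | succ n ih => rw [Nat.cast_succ, hadd hφ, hadd hψ, ih, hone]
  refine AlgHom.ext fun x => poly_eq_of_eval_nat fun n _ => ?_
  simpa [Polynomial.coe_aeval_eq_eval] using DFunLike.congr_fun (hall n) x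

end Morphism

/-! ### Linear extensions of a noncrossing partition -/

section Extensions

variable {n : ℕ}

/-- Weakly increasing maps on the blocks of `π`. -/
def IsLin (π : Partition) (f : {b // b ∈ π.blocks} → Fin n) : Prop :=
  ∀ b b', Nested b.1 b'.1 → f b ≤ f b'

/-- Strictly increasing maps on the blocks of `π`. -/
def IsLinStrict (π : Partition) (f : {b // b ∈ π.blocks} → Fin n) : Prop :=
  ∀ b b', Nested b.1 b'.1 → b ≠ b' → f b < f b'

theorem IsLinStrict.isLin {π : Partition} {f : {b // b ∈ π.blocks} → Fin n}
    (h : IsLinStrict π f) : IsLin π f := fun b b' hb => by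
  rcases eq_or_ne b b' with rfl | hne
  · exact le_rfl
  · exact (h b b' hb hne).le

/-- The block of an element. -/
noncomputable def blockOf (π : Partition) (x : ↥(π.blocks.sup id)) : {b // b ∈ π.blocks} :=
  ⟨(mem_sup_iff.1 x.2).choose, (mem_sup_iff.1 x.2).choose_spec.1⟩

theorem mem_blockOf (π : Partition) (x : ↥(π.blocks.sup id)) : x.1 ∈ (blockOf π x).1 :=
  (mem_sup_iff.1 x.2).choose_spec.2

theorem blockOf_eq {π : Partition} (b : {b // b ∈ π.blocks}) (x : ↥(π.blocks.sup id))
    (hx : x.1 ∈ b.1) : blockOf π x = b :=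
  Subtype.ext (π.noncrossing.eq_of_mem (blockOf π x).2 b.2 (mem_blockOf π x) hx)

/-- An element between two elements of a block b lies in a block nested in b, where f is at least
f(b). -/
theorem IsLin.conn {π : Partition} {f : {b // b ∈ π.blocks} → Fin n} (hf : IsLin π f)
    (x y : ↥(π.blocks.sup id)) (h : SameBlock π.blocks x y) : Conn (f ∘ blockOf π) x y := by
  obtain ⟨b, hb, hx, hy⟩ := h
  have hbx := blockOf_eq ⟨b, hb⟩ x hx
  have hby := blockOf_eq ⟨b, hb⟩ y hy
  refine ⟨by simp only [Function.comp_apply, hbx, hby], fun z hz => hf _ _ ?_⟩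
  rw [hbx]
  rcases Set.mem_uIcc.1 hz with hz | hz
  · exact π.noncrossing.nested hb (blockOf π z).2 hx (mem_blockOf π z) hy hz.1 hz.2
  · exact π.noncrossing.nested hb (blockOf π z).2 hy (mem_blockOf π z) hx hz.1 hz.2

theorem exists_between {π : Partition} {b b' : {b // b ∈ π.blocks}} (h : Nested b.1 b'.1) :
    ∃ x y z : ↥(π.blocks.sup id), x.1 ∈ b.1 ∧ y.1 ∈ b'.1 ∧ z.1 ∈ b.1 ∧ x ≤ y ∧ y ≤ z := by
  obtain ⟨y, hy⟩ := π.noncrossing.nonempty_block b'.1 b'.2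
  obtain ⟨⟨x, hx, hxy⟩, ⟨z, hz, hyz⟩⟩ := h y hy
  exact ⟨⟨x, mem_sup_of_mem b.2 hx⟩, ⟨y, mem_sup_of_mem b'.2 hy⟩, ⟨z, mem_sup_of_mem b.2 hz⟩,
    hx, hy, hz, hxy, hyz⟩

/-- A colouring with classes `merge σ` is constant on each block of π, hence comes from a unique map
on blocks. That map is increasing because a nested block has an element between two connected
elements of the outer block. -/
theorem card_isLin_merge {π : Partition} (σ : Finpartition π.blocks) :
    Nat.card {f : {b // b ∈ π.blocks} → Fin n // IsLin π f ∧ ∀ x y : ↥(π.blocks.sup id),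
      Conn (f ∘ blockOf π) x y ↔ SameBlock (merge σ) x y} = numCol (merge σ) (Fin n) := by
  rw [← numColorings_merge]
  refine Nat.card_congr (Equiv.ofBijective (fun f => ⟨f.1 ∘ blockOf π, f.2.2⟩) ⟨?_, ?_⟩)
  · intro f f' h
    refine Subtype.ext (funext fun b => ?_)
    obtain ⟨x, hx⟩ := π.noncrossing.nonempty_block b.1 b.2
    have := congrFun (congrArg Subtype.val h) ⟨x, mem_sup_of_mem b.2 hx⟩
    simpa [blockOf_eq b ⟨x, mem_sup_of_mem b.2 hx⟩ hx] using this
  · rintro ⟨c, hc⟩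
    have hne : ∀ b : {b // b ∈ π.blocks}, ∃ x : ↥(π.blocks.sup id), x.1 ∈ b.1 := fun b =>
      let ⟨x, hx⟩ := π.noncrossing.nonempty_block b.1 b.2
      ⟨⟨x, mem_sup_of_mem b.2 hx⟩, hx⟩
    choose e he using hne
    have hcb : ∀ (b : {b // b ∈ π.blocks}) (x y : ↥(π.blocks.sup id)), x.1 ∈ b.1 → y.1 ∈ b.1 →
        Conn c x y := fun b x y hx hy =>
      (hc x y).2 (sameBlock_merge_of_sameBlock σ ⟨b.1, b.2, hx, hy⟩)
    have hcomp : (c ∘ e) ∘ blockOf π = c :=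
      funext fun x => (hcb (blockOf π x) _ _ (he _) (mem_blockOf π x)).1
    refine ⟨⟨c ∘ e, fun b b' hbb => ?_, by rw [hcomp]; exact hc⟩, Subtype.ext hcomp⟩
    obtain ⟨x, y, z, hx, hy, hz, hxy, hyz⟩ := exists_between hbb
    have h1 := (hcb b x z hx hz).2 y (Set.mem_uIcc.2 (Or.inl ⟨hxy, hyz⟩))
    rwa [(hcb b x _ hx (he b)).1, (hcb b' y _ hy (he b')).1] at h1

/-- No block of the family is nested in another one. -/
def IsFlat (C : Finset (Finset ℕ)) : Prop := ∀ b ∈ C, ∀ b' ∈ C, Nested b b' → b = b'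

/-- Blocks in the same class have equal values, so strictness forbids nesting within a class.
Conversely, if b' is nested in b with the same value, nothing between an element of b and a suitable
element of b' is coloured lower, so the two blocks fall in one class. -/
theorem IsLin.isLinStrict_iff {π : Partition} {σ : Finpartition π.blocks}
    {f : {b // b ∈ π.blocks} → Fin n} (hf : IsLin π f) (h : ∀ x y : ↥(π.blocks.sup id),
      Conn (f ∘ blockOf π) x y ↔ SameBlock (merge σ) x y) :
    IsLinStrict π f ↔ ∀ C ∈ σ.parts, IsFlat C := by
  constructor
  · intro hs C hC b hb b' hb' hbb
    by_contra hne
    have hlt := hs ⟨b, σ.le hC hb⟩ ⟨b', σ.le hC hb'⟩ hbb (by simpa using hne)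
    obtain ⟨x, y, -, hx, hy, -⟩ := exists_between (π := π)
      (b := ⟨b, σ.le hC hb⟩) (b' := ⟨b', σ.le hC hb'⟩) hbb
    have hxy := ((h x y).2 (sameBlock_merge_iff_exists_part.2
      ⟨C, hC, mem_sup_of_mem hb hx, mem_sup_of_mem hb' hy⟩)).1
    simp only [Function.comp_apply, blockOf_eq _ x hx, blockOf_eq _ y hy] at hxy
    exact hlt.ne hxy
  · intro hflat b b' hbb hne
    refine lt_of_le_of_ne (hf b b' hbb) fun heq => hne (Subtype.ext ?_)
    obtain ⟨x, y, z, hx, hy, hz, hxy, hyz⟩ := exists_between hbb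
    have hxz := hf.conn x z ⟨b.1, b.2, hx, hz⟩
    -- The interval from x to y lies inside the one from x to z, whose ends belong to the same block
    -- b.
    have hconn : Conn (f ∘ blockOf π) x y := by
      refine ⟨?_, fun u hu => hxz.2 u ?_⟩
      · simpa only [Function.comp_apply, blockOf_eq _ x hx, blockOf_eq _ y hy] using heq
      · rw [Set.uIcc_of_le hxy] at hu
        exact Set.mem_uIcc.2 (Or.inl ⟨hu.1, hu.2.trans hyz⟩)
    exact hflat _ (σ.part_mem.2 b.2) b.1 (σ.mem_part b.2) b'.1
      ((sameBlock_merge σ b.2 b'.2 hx hy).1 ((h x y).1 hconn)) hbb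

open scoped Classical in
theorem card_isLin (π : Partition) (n : ℕ) :
    Nat.card {f : {b // b ∈ π.blocks} → Fin n // IsLin π f} =
      ∑ σ ∈ (Finset.univ : Finset (Finpartition π.blocks)).filter
        fun σ => IsNoncrossing (merge σ), numCol (merge σ) (Fin n) := by
  rw [card_eq_sum_merge (fun f => f.1 ∘ blockOf π) fun f => f.2.conn]
  refine Finset.sum_congr rfl fun σ _ => ?_
  rw [← card_isLin_merge]
  exact Nat.card_congr (Equiv.subtypeSubtypeEquivSubtypeInter (IsLin π) fun f =>
    ∀ x y : ↥(π.blocks.sup id), Conn (f ∘ blockOf π) x y ↔ SameBlock (merge σ) x y)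

open scoped Classical in
theorem card_isLinStrict (π : Partition) (n : ℕ) :
    Nat.card {f : {b // b ∈ π.blocks} → Fin n // IsLinStrict π f} =
      ∑ σ ∈ (Finset.univ : Finset (Finpartition π.blocks)).filter
        fun σ => IsNoncrossing (merge σ),
      numCol (merge σ) (Fin n) * if ∀ C ∈ σ.parts, IsFlat C then 1 else 0 := by
  rw [card_eq_sum_merge (fun f => f.1 ∘ blockOf π) fun f => f.2.isLin.conn]
  refine Finset.sum_congr rfl fun σ _ => ?_
  refine (Nat.card_congr (Equiv.subtypeSubtypeEquivSubtypeInter (IsLinStrict π) fun f =>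
    ∀ x y : ↥(π.blocks.sup id), Conn (f ∘ blockOf π) x y ↔ SameBlock (merge σ) x y)).trans ?_
  split_ifs with h
  · rw [← card_isLin_merge, mul_one]
    exact Nat.card_congr (Equiv.subtypeEquivRight fun f =>
      ⟨fun H => ⟨H.1.isLin, H.2⟩, fun H => ⟨(H.1.isLinStrict_iff H.2).2 h, H.2⟩⟩)
  · rw [mul_zero]
    refine Nat.card_eq_zero.2 (Or.inl ⟨fun f => h ?_⟩)
    exact (f.2.1.isLin.isLinStrict_iff f.2.2).1 f.2.1

/-! ### Linear extensions of a monomial -/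

/-- A map on the blocks of P is a family of maps, one for each factor counted with multiplicity, and
blocks of different factors impose no joint condition. -/
theorem card_bl (G : ∀ π : Partition, ({b // b ∈ π.blocks} → Fin n) → Prop)
    (P : Partition →₀ ℕ) :
    Nat.card {f : Bl P → Fin n // ∀ c : (Σ π : {π // π ∈ P.support}, Fin (P π)),
      G c.1.1 fun b => f ⟨c, b⟩} =
      ∏ π ∈ P.support, Nat.card {f // G π f} ^ P π := by
  have e : {f : Bl P → Fin n // ∀ c : (Σ π : {π // π ∈ P.support}, Fin (P π)),
      G c.1.1 fun b => f ⟨c, b⟩} ≃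
      ∀ c : (Σ π : {π // π ∈ P.support}, Fin (P π)), {f // G c.1.1 f} :=
    ((Equiv.piCurry fun _ _ => Fin n).subtypeEquiv 
      (q := fun g => ∀ c : (Σ π : {π // π ∈ P.support}, Fin (P π)), G c.1.1 (g c))
      fun f => Iff.rfl).trans Equiv.subtypePiEquivPi
  rw [Nat.card_congr e, Nat.card_pi, Fintype.prod_sigma]
  simpa using Finset.prod_coe_sort P.support fun π => Nat.card {f // G π f} ^ P π

theorem ncard_lin (P : Partition →₀ ℕ) (n : ℕ) : (Lin P n).ncard =
    ∏ π ∈ P.support, Nat.card {f : {b // b ∈ π.blocks} → Fin n // IsLin π f} ^ P π := by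
  rw [← card_bl, ← Nat.card_coe_set_eq]
  refine Nat.card_congr (Equiv.subtypeEquivRight fun f => ⟨fun h c b b' hb => h _ _ ⟨rfl, hb⟩, ?_⟩)
  rintro h ⟨c, b⟩ ⟨c', b'⟩ ⟨hc, hb⟩
  obtain rfl : c = c' := hc
  exact h c b b' hb

theorem ncard_linStrict (P : Partition →₀ ℕ) (n : ℕ) : (LinStrict P n).ncard =
    ∏ π ∈ P.support, Nat.card {f : {b // b ∈ π.blocks} → Fin n // IsLinStrict π f} ^ P π := by
  rw [← card_bl, ← Nat.card_coe_set_eq]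
  refine Nat.card_congr (Equiv.subtypeEquivRight fun f => ⟨fun h c b b' hb hne =>
    h _ _ ⟨rfl, hb⟩ fun e => hne (by simpa using e), ?_⟩)
  rintro h ⟨c, b⟩ ⟨c', b'⟩ ⟨hc, hb⟩ hne
  obtain rfl : c = c' := hc
  exact h c b b' hb fun e => hne (by rw [e])

end Extensions

/-! ### The two characters -/

section Characters

variable {K : Type*} [Field K]

theorem eval_map_monomial (F : Alg K →ₐ[K] K[X]) (a : K) (P : Partition →₀ ℕ) :
    (F (MvPolynomial.monomial P 1)).eval a =
      ∏ π ∈ P.support, (F (MvPolynomial.X π)).eval a ^ P π := by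
  rw [MvPolynomial.monomial_eq, map_one, one_mul, Finsupp.prod, map_prod, Polynomial.eval_prod]
  simp

theorem charOne_gen (B : Finset (Finset ℕ)) : charOne K (gen K B) = 1 := by
  unfold gen charOne
  split_ifs <;> simp

theorem nested_image_rank {C : Finset (Finset ℕ)} {b b' : Finset ℕ} (hb : b ∈ C) (hb' : b' ∈ C) :
    Nested (b.image (rank (C.sup id))) (b'.image (rank (C.sup id))) ↔ Nested b b' := by
  have hle : ∀ {d d' : Finset ℕ} {x y : ℕ}, d ∈ C → d' ∈ C → x ∈ d → y ∈ d' →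
      (rank (C.sup id) x ≤ rank (C.sup id) y ↔ x ≤ y) := by
    intro d d' x y hd hd' hx hy
    rw [← not_lt, rank_lt_rank_iff (mem_sup_of_mem hd' hy) (mem_sup_of_mem hd hx), not_lt]
  constructor
  · intro h y hy
    obtain ⟨⟨_, hu, hxy⟩, ⟨_, hv, hyz⟩⟩ := h _ (Finset.mem_image_of_mem _ hy)
    obtain ⟨x, hx, rfl⟩ := Finset.mem_image.1 hu
    obtain ⟨z, hz, rfl⟩ := Finset.mem_image.1 hv
    exact ⟨⟨x, hx, (hle hb hb' hx hy).1 hxy⟩, ⟨z, hz, (hle hb' hb hy hz).1 hyz⟩⟩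
  · intro h _ hu
    obtain ⟨y, hy, rfl⟩ := Finset.mem_image.1 hu
    obtain ⟨⟨x, hx, hxy⟩, ⟨z, hz, hyz⟩⟩ := h y hy
    exact ⟨⟨_, Finset.mem_image_of_mem _ hx, (hle hb hb' hx hy).2 hxy⟩,
      ⟨_, Finset.mem_image_of_mem _ hz, (hle hb' hb hy hz).2 hyz⟩⟩

/-- Allows λˢ, defined on standardized generators, to be read directly on the classes of an
equivalence. -/
theorem isFlat_std {C : Finset (Finset ℕ)} : IsFlat (std C) ↔ IsFlat C := by
  constructor
  · intro h b hb b' hb' hbb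
    have himg := h _ (Finset.mem_image_of_mem _ hb) _ (Finset.mem_image_of_mem _ hb')
      ((nested_image_rank hb hb').2 hbb)
    have hsub : ∀ {d d' : Finset ℕ}, d ∈ C → d' ∈ C →
        d.image (rank (C.sup id)) = d'.image (rank (C.sup id)) → d ⊆ d' := by
      intro d d' hd hd' hdd x hx
      obtain ⟨y, hy, hxy⟩ := Finset.mem_image.1 (hdd ▸ Finset.mem_image_of_mem _ hx)
      rwa [← rank_inj (mem_sup_of_mem hd' hy) (mem_sup_of_mem hd hx) hxy]
    exact (hsub hb hb' himg).antisymm (hsub hb' hb himg.symm)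
  · intro h _ hd _ hd' hdd
    obtain ⟨b, hb, rfl⟩ := Finset.mem_image.1 hd
    obtain ⟨b', hb', rfl⟩ := Finset.mem_image.1 hd'
    rw [h b hb b' hb' ((nested_image_rank hb hb').1 hdd)]

theorem blocks_eq_base_iff (π : Partition) : π.blocks = base π ↔ IsFlat π.blocks := by
  classical
  rw [base, eq_comm, Finset.filter_eq_self]
  exact ⟨fun h b hb b' hb' hbb => h b' hb' b hb hbb, fun h b hb b' hb' hbb => h b' hb' b hb hbb⟩

open scoped Classical in
theorem charStrict_gen {C : Finset (Finset ℕ)} (h : C.Nonempty) (hC : IsNoncrossing C) :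
    charStrict K (gen K C) = if IsFlat C then 1 else 0 := by
  rw [gen_of_isNoncrossing h hC, charStrict, MvPolynomial.aeval_X]
  simp only [blocks_eq_base_iff]
  exact if_congr isFlat_std rfl rfl

/-! ### The counting polynomials as actions of characters -/

theorem isLinPoly_act [CharZero K] :
    IsLinPoly (act (colorHom K) (charOne K)).toLinearMap := by
  intro P n _
  rw [AlgHom.toLinearMap_apply, eval_map_monomial, ncard_lin]
  push_cast
  refine Finset.prod_congr rfl fun π _ => ?_
  rw [eval_act_X, card_isLin]
  simp [charOne_gen]

theorem isStrictLinPoly_act [CharZero K] :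
    IsStrictLinPoly (act (colorHom K) (charStrict K)).toLinearMap := by
  classical
  intro P n _
  rw [AlgHom.toLinearMap_apply, eval_map_monomial, ncard_linStrict]
  push_cast
  refine Finset.prod_congr rfl fun π _ => ?_
  rw [eval_act_X, card_isLinStrict]
  push_cast
  congr 1
  refine Finset.sum_congr rfl fun σ _ => ?_
  -- The product of the values of λˢ over the classes is 1 if every class is flat and 0 otherwise.
  rw [Finset.prod_congr rfl fun C hC => charStrict_gen (σ.nonempty_of_mem_parts hC)
    (π.noncrossing.mono (σ.le hC)), Finset.prod_boole]

theorem IsLinPoly.unique [CharZero K] {L L' : Alg K →ₗ[K] K[X]} (h : IsLinPoly L)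
    (h' : IsLinPoly L') : L = L' :=
  MvPolynomial.basisMonomials Partition K |>.ext fun P => poly_eq_of_eval_nat fun n hn => by
    simpa using (h P n hn).trans (h' P n hn).symm

theorem IsStrictLinPoly.unique [CharZero K] {L L' : Alg K →ₗ[K] K[X]} (h : IsStrictLinPoly L)
    (h' : IsStrictLinPoly L') : L = L' :=
  MvPolynomial.basisMonomials Partition K |>.ext fun P => poly_eq_of_eval_nat fun n hn => by
    simpa using (h P n hn).trans (h' P n hn).symm

end Characters

end NCP

theorem corollary3p24 (K : Type*) [Field K] [CharZero K] :
    (∃! φ : NCP.Alg K →ₐ[K] K[X], NCP.IsDoubleBialgHom φ) ∧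
    (∃! L : NCP.Alg K →ₗ[K] K[X], NCP.IsLinPoly L) ∧
    (∃! Ls : NCP.Alg K →ₗ[K] K[X], NCP.IsStrictLinPoly Ls) ∧
    ∀ (φ : NCP.Alg K →ₐ[K] K[X]) (L Ls : NCP.Alg K →ₗ[K] K[X]),
      NCP.IsDoubleBialgHom φ → NCP.IsLinPoly L → NCP.IsStrictLinPoly Ls →
        L = (NCP.act φ (NCP.charOne K)).toLinearMap ∧
        Ls = (NCP.act φ (NCP.charStrict K)).toLinearMap := by
  refine ⟨⟨NCP.colorHom K, NCP.isDoubleBialgHom_colorHom, fun _ h =>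
      h.unique NCP.isDoubleBialgHom_colorHom⟩,
    ⟨_, NCP.isLinPoly_act, fun _ h => h.unique NCP.isLinPoly_act⟩,
    ⟨_, NCP.isStrictLinPoly_act, fun _ h => h.unique NCP.isStrictLinPoly_act⟩, ?_⟩
  intro φ L Ls hφ hL hLs
  obtain rfl := hφ.unique NCP.isDoubleBialgHom_colorHom
  exact ⟨hL.unique NCP.isLinPoly_act, hLs.unique NCP.isStrictLinPoly_act⟩
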